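/- Let $\Bbbk$ be a field, let $n,d\geq 1$ be integers, and let $q\in\Bbbk^*$ satisfy $q^d\neq 1$ (for instance, $q$ not a root of unity). Let $\underline{q}=(q,\ldots,q)$ and let $A(n,d,\underline{q})=\bigotimes_{i=1}^n \Bbbk[h_i^{\pm1}](\sigma_i,h_i^d-1)$ be the $\Bbbk$-algebra generated by $x_i,y_i,h_i,h_i^{-1}$ ($1\leq i\leq n$) subject to the relations $$x_ih_i=q\,h_ix_i,\quad y_ih_i=q^{-1}h_iy_i,\quad x_iy_i=(qh_i)^d-1,\quad y_ix_i=h_i^d-1,\quad h_ih_i^{-1}=h_i^{-1}h_i=1,$$ and $h_ih_j=h_jh_i$, $h_ix_j=x_jh_i$, $h_iy_j=y_jh_i$, $x_ix_j=x_jx_i$, $x_iy_j=y_jx_i$, $y_iy_j=y_jy_i$ for $i\neq j$. Here $\sigma_i$ denotes the automorphism of $\Bbbk[h_1^{\pm1},\ldots,h_n^{\pm1}]$ with $\sigma_i(h_i)=qh_i$ and $\sigma_i(h_j)=h_j$ for $j\neq i$. Consider the following three families of $\Bbbk$-algebra automorphisms of $A(n,d,\underline{q})$: 1. $\phi_g=g\otimes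 1\otimes\cdots\otimes 1$, for $g$ a $\Bbbk$-algebra automorphism of the first tensor factor $A(1,d,q)=\Bbbk[h_1^{\pm1}](\sigma_1,h_1^d-1)$; 2. $\chi_w$, for $w$ a permutation of $\{1,\ldots,n\}$, given by $h_i\mapsto h_{w(i)}$, $x_i\mapsto x_{w(i)}$, $y_i\mapsto y_{w(i)}$; 3. $\xi_{\underline{u}}$, for $\underline{u}=(u_1,\ldots,u_n)$ a vector of units of $A(n,d,\underline{q})$ (these lie in $\Bbbk[h_1^{\pm1},\ldots,h_n^{\pm1}]$) such that $u_i\sigma_i(u_l)=u_l\sigma_l(u_i)$ for all $l\neq i$, given by $h_i\mapsto h_i$, $x_i\mapsto u_ix_i$, $y_i\mapsto y_iu_i^{-1}$. An automorphism of $A(n,d,\underline{q})$ is called qwa-tame if it lies in the subgroup of the group of $\Bbbk$-algebra automorphisms generated by these three families. Then every $\Bbbk$-algebra automorphism of $A(n,d,\underline{q})$ is qwa-tame. -/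

import Mathlib

noncomputable section

namespace QWA

/-- The symbols `x_i`, `y_i`, `h_i`, `h_i⁻¹` for `i = 1, …, n` (indexed by `Fin n`). -/
inductive Gen (n : ℕ) : Type
  | x (i : Fin n)
  | y (i : Fin n)
  | h (i : Fin n)
  | hInv (i : Fin n)

variable {k : Type*} [Field k] {n : ℕ}

/-- The symbols `x_i`, `y_i`, `h_i`, `h_i⁻¹` as elements of the free associative algebra. -/
abbrev fx (k : Type*) [Field k] {n : ℕ} (i : Fin n) : FreeAlgebra k (Gen n) :=
  FreeAlgebra.ι k (Gen.x i)

/-- See `fx`. -/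
abbrev fy (k : Type*) [Field k] {n : ℕ} (i : Fin n) : FreeAlgebra k (Gen n) :=
  FreeAlgebra.ι k (Gen.y i)

/-- See `fx`. -/
abbrev fh (k : Type*) [Field k] {n : ℕ} (i : Fin n) : FreeAlgebra k (Gen n) :=
  FreeAlgebra.ι k (Gen.h i)

/-- See `fx`. -/
abbrev fhInv (k : Type*) [Field k] {n : ℕ} (i : Fin n) : FreeAlgebra k (Gen n) :=
  FreeAlgebra.ι k (Gen.hInv i)

/-- The defining relations of `A(n,d,(q_1,…,q_n))`: the relations of the generalized Weyl algebra
`k[h_i^{±1}](σ_i, h_i^d - 1)`, where `σ_i(h_i) = q_i h_i`, in each of the `n` tensor factors, and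
the commutation of generators of different factors. -/
inductive Rel (d : ℕ) (q : Fin n → kˣ) : FreeAlgebra k (Gen n) → FreeAlgebra k (Gen n) → Prop
  | x_h (i : Fin n) : Rel d q (fx k i * fh k i) ((q i : k) • (fh k i * fx k i))
  | y_h (i : Fin n) : Rel d q (fy k i * fh k i) ((((q i)⁻¹ : kˣ) : k) • (fh k i * fy k i))
  | x_y (i : Fin n) : Rel d q (fx k i * fy k i) (((q i : k) • fh k i) ^ d - 1)
  | y_x (i : Fin n) : Rel d q (fy k i * fx k i) (fh k i ^ d - 1)
  | h_hInv (i : Fin n) : Rel d q (fh k i * fhInv k i) 1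
  | hInv_h (i : Fin n) : Rel d q (fhInv k i * fh k i) 1
  | comm_h_h (i j : Fin n) : i ≠ j → Rel d q (fh k i * fh k j) (fh k j * fh k i)
  | comm_h_x (i j : Fin n) : i ≠ j → Rel d q (fh k i * fx k j) (fx k j * fh k i)
  | comm_h_y (i j : Fin n) : i ≠ j → Rel d q (fh k i * fy k j) (fy k j * fh k i)
  | comm_x_x (i j : Fin n) : i ≠ j → Rel d q (fx k i * fx k j) (fx k j * fx k i)
  | comm_x_y (i j : Fin n) : i ≠ j → Rel d q (fx k i * fy k j) (fy k j * fx k i)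
  | comm_y_y (i j : Fin n) : i ≠ j → Rel d q (fy k i * fy k j) (fy k j * fy k i)

/-- The quantum Weyl analogue algebra `A(n,d,(q_1,…,q_n))`, by generators and relations. -/
def QWAlg (d : ℕ) (q : Fin n → kˣ) : Type _ := RingQuot (Rel d q)

instance (d : ℕ) (q : Fin n → kˣ) : Ring (QWAlg d q) :=
  inferInstanceAs (Ring (RingQuot (Rel d q)))

instance (d : ℕ) (q : Fin n → kˣ) : Algebra k (QWAlg d q) :=
  inferInstanceAs (Algebra k (RingQuot (Rel d q)))

/-- The quotient map from the free algebra. -/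
def mk (d : ℕ) (q : Fin n → kˣ) : FreeAlgebra k (Gen n) →ₐ[k] QWAlg d q :=
  RingQuot.mkAlgHom k (Rel d q)

theorem mk_rel {d : ℕ} {q : Fin n → kˣ} {a b : FreeAlgebra k (Gen n)} (hab : Rel d q a b) :
    mk d q a = mk d q b :=
  RingQuot.mkAlgHom_rel k hab

/-- The generator `x_i` of `A(n,d,q)`. -/
def X (d : ℕ) (q : Fin n → kˣ) (i : Fin n) : QWAlg d q := mk d q (fx k i)

/-- The generator `y_i` of `A(n,d,q)`. -/
def Y (d : ℕ) (q : Fin n → kˣ) (i : Fin n) : QWAlg d q := mk d q (fy k i)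

/-- The invertible generator `h_i` of `A(n,d,q)`, with its inverse `h_i⁻¹`. -/
def H (d : ℕ) (q : Fin n → kˣ) (i : Fin n) : (QWAlg d q)ˣ where
  val := mk d q (fh k i)
  inv := mk d q (fhInv k i)
  val_inv := by rw [← map_mul, mk_rel (Rel.h_hInv i), map_one]
  inv_val := by rw [← map_mul, mk_rel (Rel.hInv_h i), map_one]

theorem H_commute (d : ℕ) (q : Fin n → kˣ) (i j : Fin n) : Commute (H d q i) (H d q j) := by
  rcases eq_or_ne i j with rfl | hij
  · exact Commute.refl _
  · refine Units.ext ?_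
    change mk d q (fh k i) * mk d q (fh k j) = mk d q (fh k j) * mk d q (fh k i)
    rw [← map_mul, mk_rel (Rel.comm_h_h i j hij), map_mul]

/-- The embedding of the `i`-th tensor factor: the algebra map `A(1,d,q_i) → A(n,d,q)` sending
`x_1, y_1, h_1` to `x_i, y_i, h_i`. -/
def factor (d : ℕ) (q : Fin n → kˣ) (i : Fin n) :
    QWAlg d (fun _ : Fin 1 => q i) →ₐ[k] QWAlg d q :=
  RingQuot.liftAlgHom k ⟨FreeAlgebra.lift k (fun g : Gen 1 => match g with
      | Gen.x _ => mk d q (fx k i)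
      | Gen.y _ => mk d q (fy k i)
      | Gen.h _ => mk d q (fh k i)
      | Gen.hInv _ => mk d q (fhInv k i)), by
    intro a b hab
    cases hab with
    | x_h => simpa using mk_rel (Rel.x_h (d := d) (q := q) i)
    | y_h => simpa using mk_rel (Rel.y_h (d := d) (q := q) i)
    | x_y => simpa using mk_rel (Rel.x_y (d := d) (q := q) i)
    | y_x => simpa using mk_rel (Rel.y_x (d := d) (q := q) i)
    | h_hInv => simpa using mk_rel (Rel.h_hInv (d := d) (q := q) i)
    | hInv_h => simpa using mk_rel (Rel.hInv_h (d := d) (q := q) i)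
    | comm_h_h a b hne => exact absurd (Subsingleton.elim a b) hne
    | comm_h_x a b hne => exact absurd (Subsingleton.elim a b) hne
    | comm_h_y a b hne => exact absurd (Subsingleton.elim a b) hne
    | comm_x_x a b hne => exact absurd (Subsingleton.elim a b) hne
    | comm_x_y a b hne => exact absurd (Subsingleton.elim a b) hne
    | comm_y_y a b hne => exact absurd (Subsingleton.elim a b) hne⟩

/-- The Laurent polynomial ring `k[h_1^{±1}, …, h_n^{±1}]`, as the group algebra of `ℤⁿ`. -/
abbrev Laurent (k : Type*) [Field k] (n : ℕ) : Type _ := AddMonoidAlgebra k (Fin n → ℤ)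

/-- The `k`-algebra map `σ_i` of `k[h_1^{±1}, …, h_n^{±1}]` with `σ_i(h_i) = q_i h_i` and
`σ_i(h_j) = h_j` for `j ≠ i`; it sends the monomial `h^m` to `q_i^{m_i} h^m`. -/
def sigma (q : Fin n → kˣ) (i : Fin n) : Laurent k n →ₐ[k] Laurent k n :=
  AddMonoidAlgebra.lift k (Laurent k n) (Fin n → ℤ)
    { toFun := fun m => AddMonoidAlgebra.single m.toAdd (((q i) ^ (m.toAdd i) : kˣ) : k)
      map_one' := by simp [AddMonoidAlgebra.one_def]
      map_mul' := fun a b => by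
        simp [AddMonoidAlgebra.single_mul_single, zpow_add] }

theorem H_zpow_pairwise (d : ℕ) (q : Fin n → kˣ) (m : Fin n → ℤ) :
    ((Finset.univ : Finset (Fin n)) : Set (Fin n)).Pairwise
      (Function.onFun Commute fun i => H d q i ^ m i) :=
  fun i _ j _ _ => (H_commute d q i j).zpow_zpow (m i) (m j)

/-- The monomial `h^m = h_1^{m_1} ⋯ h_n^{m_n}` in `A(n,d,q)`, for `m ∈ ℤⁿ`. -/
def hPow (d : ℕ) (q : Fin n → kˣ) (m : Fin n → ℤ) : (QWAlg d q)ˣ :=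
  Finset.univ.noncommProd (fun i => H d q i ^ m i) (H_zpow_pairwise d q m)

theorem hPow_zero (d : ℕ) (q : Fin n → kˣ) : hPow d q 0 = 1 :=
  (Finset.noncommProd_eq_pow_card _ _ _ 1 (by simp)).trans (one_pow _)

theorem hPow_add (d : ℕ) (q : Fin n → kˣ) (a b : Fin n → ℤ) :
    hPow d q (a + b) = hPow d q a * hPow d q b := by
  unfold hPow
  refine Eq.trans (Finset.noncommProd_congr rfl (fun i _ => ?_) _)
    (Finset.noncommProd_mul_distrib (fun i => H d q i ^ a i) (fun i => H d q i ^ b i)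
      (H_zpow_pairwise d q a) (H_zpow_pairwise d q b)
      (fun i _ j _ _ => (H_commute d q i j).zpow_zpow _ _))
  simp [zpow_add]

/-- The inclusion of `k[h_1^{±1}, …, h_n^{±1}]` into `A(n,d,q)`, sending the monomial `h^m` to
`h_1^{m_1} ⋯ h_n^{m_n}`. -/
def ofLaurent (d : ℕ) (q : Fin n → kˣ) : Laurent k n →ₐ[k] QWAlg d q :=
  AddMonoidAlgebra.lift k (QWAlg d q) (Fin n → ℤ)
    { toFun := fun m => (hPow d q m.toAdd : QWAlg d q)
      map_one' := by
        change ((hPow d q 0 : (QWAlg d q)ˣ) : QWAlg d q) = 1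
        rw [hPow_zero, Units.val_one]
      map_mul' := fun a b => by
        change ((hPow d q (a.toAdd + b.toAdd) : (QWAlg d q)ˣ) : QWAlg d q) = _
        rw [hPow_add, Units.val_mul] }

/-- The group of `k`-algebra automorphisms of `A(n,d,(q,…,q))`. -/
abbrev Aut (n d : ℕ) (q : kˣ) : Type _ :=
  QWAlg d (fun _ : Fin n => q) ≃ₐ[k] QWAlg d (fun _ : Fin n => q)

/-- `ψ = φ_g = g ⊗ 1 ⊗ ⋯ ⊗ 1`, for an automorphism `g` of the tensor factor `A(1,d,q)`: `ψ` acts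
as `g` on the first tensor factor and trivially on all the others. -/
def IsPhi {d : ℕ} {q : kˣ} [NeZero n] (g : Aut 1 d q) (ψ : Aut n d q) : Prop :=
  (∀ a : QWAlg d (fun _ : Fin 1 => q),
    ψ (factor d (fun _ : Fin n => q) 0 a) = factor d (fun _ : Fin n => q) 0 (g a)) ∧
  ∀ j : Fin n, j ≠ 0 →
    ψ (H d (fun _ => q) j) = H d (fun _ => q) j ∧
    ψ (X d (fun _ => q) j) = X d (fun _ => q) j ∧
    ψ (Y d (fun _ => q) j) = Y d (fun _ => q) j

/-- `ψ = χ_w`, the automorphism permuting the tensor factors by `w`. -/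
def IsChi {d : ℕ} {q : kˣ} (w : Equiv.Perm (Fin n)) (ψ : Aut n d q) : Prop :=
  ∀ i : Fin n,
    ψ (H d (fun _ => q) i) = H d (fun _ => q) (w i) ∧
    ψ (X d (fun _ => q) i) = X d (fun _ => q) (w i) ∧
    ψ (Y d (fun _ => q) i) = Y d (fun _ => q) (w i)

/-- The vectors `u = (u_1, …, u_n)` of units of `A(n,d,(q,…,q))` (all of them belonging to
`k[h_1^{±1}, …, h_n^{±1}]`, where the `σ_i` are defined) such that
`u_i σ_i(u_l) = u_l σ_l(u_i)` for `l ≠ i`. -/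
def IsAdmissible {d : ℕ} {q : kˣ} (u : Fin n → (QWAlg d (fun _ : Fin n => q))ˣ) : Prop :=
  ∃ p : Fin n → Laurent k n,
    (∀ i, ofLaurent d (fun _ => q) (p i) = u i) ∧
    ∀ i l, l ≠ i →
      p i * sigma (fun _ => q) i (p l) = p l * sigma (fun _ => q) l (p i)

/-- `ψ = ξ_u`: `ψ(h_i) = h_i`, `ψ(x_i) = u_i x_i`, `ψ(y_i) = y_i u_i⁻¹`. -/
def IsXi {d : ℕ} {q : kˣ} (u : Fin n → (QWAlg d (fun _ : Fin n => q))ˣ)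
    (ψ : Aut n d q) : Prop :=
  ∀ i : Fin n,
    ψ (H d (fun _ => q) i) = H d (fun _ => q) i ∧
    ψ (X d (fun _ => q) i) = u i * X d (fun _ => q) i ∧
    ψ (Y d (fun _ => q) i) = Y d (fun _ => q) i * ((u i)⁻¹ : (QWAlg d (fun _ => q))ˣ)

/-- The group of qwa-tame automorphisms of `A(n,d,(q,…,q))`: the subgroup generated by the
automorphisms `φ_g`, `χ_w` and `ξ_u`. -/
def qwaTame (n d : ℕ) (q : kˣ) [NeZero n] : Subgroup (Aut n d q) :=
  Subgroup.closure
    ({ψ | ∃ g : Aut 1 d q, IsPhi g ψ} ∪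
     {ψ | ∃ w : Equiv.Perm (Fin n), IsChi w ψ} ∪
     {ψ | ∃ u : Fin n → (QWAlg d (fun _ : Fin n => q))ˣ, IsAdmissible u ∧ IsXi u ψ})

end QWA

end

/-! The algebra A embeds in the quantum torus, the skew group algebra of `ℤⁿ` over the Laurent
polynomials L in the `h_i`, by `x_i ↦ t_i`, `y_i ↦ (h_i^d - 1) t_i⁻¹`. The torus is a domain graded
by a group with unique products, so factors of nonzero homogeneous elements are homogeneous. The
image of A is not all of it: a coefficient of degree `p` with `p_j < 0` is divisible by the nonunit
`q_j^{d(1+p_j)} h_j^d - 1` (`binom_dvd_coeff`). Everything rests on playing the grading against this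
divisibility.

A unit of A is homogeneous with unit coefficient, so neither it nor its inverse has a negative
degree component; hence units are the scaled monomials `α h^m` (`exists_eq_unitMonomial`).

An automorphism ψ therefore sends `h_i` to some `α h^m`. Since `x_i y_i` goes to a nonzero element
of L, `ψ(x_i)` and `ψ(y_i)` are homogeneous of opposite degrees `p`, `-p`, and `x_i h_i = q h_i x_i`
with `q ≠ 1` forces `p` and `m` to be nonzero. If `p_j ≠ 0`, one of the two images has negative
degree at `j`, so a binomial in `h_j` divides a binomial in `h^{dm}`; evaluating at a root shows
that `m` involves `h_j` alone. So each index `i` is sent to a single index `w(i)`. Comparison with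
`ψ⁻¹` makes `w` a permutation and the exponent of `h` equal to ±1; surjectivity makes the degree of
`x` equal to ±1; and divisibility leaves only a unit as the other coefficient (`exists_perm`).

After composition with a permutation of the factors, what remains in each factor is, up to units of
L, a scaling of `h`, an inversion of `h` (possible only if `q⁻¹ = q`), or an exchange of `x` and
`y`. Each is undone by an automorphism of `A(1,d,q)`, transported from the first factor to any other
by a transposition. The result fixes all `h_i` and multiplies each `x_i` by a unit; applying it to
`x_i x_l = x_l x_i` gives precisely the condition for being some `ξ_u`. -/

noncomputable section

/-! ### Homogeneous factors in skew group algebras -/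

namespace SkewMonoidAlgebra

variable {R G : Type*} [Semiring R] [Monoid G] [MulSemiringAction G R]

/-- The coefficient of a product at a group element reached in at most one way. -/
theorem coeff_mul_mul_of_uniqueMul {f g : SkewMonoidAlgebra R G} {a b : G}
    (h : UniqueMul f.support g.support a b) :
    (f * g).coeff (a * b) = f.coeff a * a • g.coeff b := by
  classical
  simp_rw [coeff_mul, sum_def, Finsupp.sum, ← Finset.sum_product']
  refine (Finset.sum_eq_single (a, b) ?_ ?_).trans (if_pos rfl) <;> simp_rw [Finset.mem_product]
  · refine fun ab hab hne ↦ if_neg (fun he ↦ hne <| Prod.ext ?_ ?_)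
    exacts [(h hab.1 hab.2 he).1, (h hab.1 hab.2 he).2]
  · refine fun hnotMem ↦ ite_eq_right_iff.mpr (fun _ ↦ ?_)
    rcases not_and_or.mp hnotMem with af | bg
    · rw [Finsupp.notMem_support_iff.mp af, zero_mul]
    · rw [Finsupp.notMem_support_iff.mp bg, smul_zero, mul_zero]

theorem exists_eq_single_of_card_support {R G : Type*} [Semiring R] [Nonempty G]
    {f : SkewMonoidAlgebra R G} (h : f.support.card ≤ 1) :
    ∃ p a, f = single p a := by
  rcases Finsupp.card_support_le_one'.1 h with ⟨p, a, e⟩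
  exact ⟨p, a, coeff_injective e⟩

/-- The factors of a nonzero homogeneous element are homogeneous. -/
theorem exists_eq_single_of_mul_eq_single {R G : Type*} [Semiring R] [NoZeroDivisors R]
    [Group G] [MulSemiringAction G R] [TwoUniqueProds G] {f g : SkewMonoidAlgebra R G} {p : G}
    {c : R} (hc : c ≠ 0) (h : f * g = single p c) :
    ∃ p₁ a p₂ b, f = single p₁ a ∧ g = single p₂ b ∧ p₁ * p₂ = p ∧ a * p₁ • b = c := by
  have hfg : f * g ≠ 0 := by rwa [h, Ne, single_eq_zero]
  have hf : f.support.Nonempty := by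
    rw [Finset.nonempty_iff_ne_empty, Ne, support_eq_empty]
    rintro rfl
    simp at hfg
  have hg : g.support.Nonempty := by
    rw [Finset.nonempty_iff_ne_empty, Ne, support_eq_empty]
    rintro rfl
    simp at hfg
  -- The coefficient of `f * g` at a uniquely attained product is `f_a · (a • g_b)`, which is
  -- nonzero; the only degree available is `p`.
  have key : ∀ a ∈ f.support, ∀ b ∈ g.support, UniqueMul f.support g.support a b → a * b = p := by
    intro a ha b hb hu
    by_contra hne
    have := coeff_mul_mul_of_uniqueMul hu
    rw [h, coeff_single, Finsupp.single_eq_of_ne hne] at this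
    rw [mem_support_iff] at ha hb
    exact mul_ne_zero ha ((smul_ne_zero_iff_ne a).2 hb) this.symm
  -- With more than one pair of degrees there would be two distinct uniquely attained products; both
  -- equal `p`, which contradicts uniqueness.
  have hcard : f.support.card * g.support.card ≤ 1 := by
    by_contra! hlt
    obtain ⟨p1, h1, p2, h2, hne, hu1, hu2⟩ := TwoUniqueProds.uniqueMul_of_one_lt_card hlt
    rw [Finset.mem_product] at h1 h2
    have e1 := key _ h1.1 _ h1.2 hu1
    have e2 := key _ h2.1 _ h2.2 hu2
    obtain ⟨e, e'⟩ := hu1 h2.1 h2.2 (e2.trans e1.symm)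
    exact hne (Prod.ext e e').symm
  have hf1 := hf.card_pos
  have hg1 := hg.card_pos
  obtain ⟨p₁, a, rfl⟩ := exists_eq_single_of_card_support (f := f) (by nlinarith)
  obtain ⟨p₂, b, rfl⟩ := exists_eq_single_of_card_support (f := g) (by nlinarith)
  rw [single_mul_single] at h hfg
  rw [Ne, single_eq_zero] at hfg
  obtain rfl : p₁ * p₂ = p := by
    by_contra hne
    have := congrArg (fun z => coeff z (p₁ * p₂)) h
    simp only [coeff_single, Finsupp.single_eq_same, Finsupp.single_eq_of_ne hne] at this
    exact hfg this
  exact ⟨p₁, a, p₂, b, rfl, rfl, rfl, single_injective _ h⟩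

/-- The elements with support in a given submonoid. -/
def supportedIn (k : Type*) {R G : Type*} [CommSemiring k] [Semiring R] [Algebra k R]
    [Monoid G] [MulSemiringAction G R] [SMulCommClass G k R] (T : Submonoid G) :
    Subalgebra k (SkewMonoidAlgebra R G) where
  carrier := {f | ∀ p ∈ f.support, p ∈ T}
  mul_mem' {f g} hf hg p hp := by
    classical
    obtain ⟨a, ha, b, hb, rfl⟩ := Finset.mem_mul.1 (support_mul f g hp)
    exact T.mul_mem (hf a ha) (hg b hb)
  add_mem' {f g} hf hg p hp := by
    classical
    rcases Finset.mem_union.1 (support_add hp) with h | h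
    exacts [hf p h, hg p h]
  algebraMap_mem' r p hp := by
    have := support_single_subset hp
    rw [Finset.mem_singleton] at this
    exact this ▸ T.one_mem

theorem single_mem_supportedIn {k : Type*} {R G : Type*} [CommSemiring k] [Semiring R]
    [Algebra k R] [Monoid G] [MulSemiringAction G R] [SMulCommClass G k R] {T : Submonoid G}
    {p : G} (hp : p ∈ T) (a : R) : single p a ∈ supportedIn k (R := R) T := by
  intro r hr
  have := support_single_subset hr
  rw [Finset.mem_singleton] at this
  exact this ▸ hp

theorem mem_of_single_mem_supportedIn {k : Type*} {R G : Type*} [CommSemiring k] [Semiring R]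
    [Algebra k R] [Monoid G] [MulSemiringAction G R] [SMulCommClass G k R] {T : Submonoid G}
    {p : G} {a : R} (ha : a ≠ 0) (h : single p a ∈ supportedIn k (R := R) T) : p ∈ T :=
  h p (by simpa using ha)

end SkewMonoidAlgebra

/-! ### Units of group algebras -/

namespace AddMonoidAlgebra

/-- The units of the group algebra of a group with unique products are the monomials. -/
theorem exists_eq_single_of_mul_eq_one {R G : Type*} [Semiring R] [NoZeroDivisors R]
    [Nontrivial R] [AddGroup G] [TwoUniqueSums G] {f g : AddMonoidAlgebra R G} (h : f * g = 1) :
    ∃ p a, a ≠ 0 ∧ f = single p a := by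
  have hfg : f * g ≠ 0 := by rw [h]; exact one_ne_zero
  have hf : f.coeff.support.Nonempty := by
    rw [Finset.nonempty_iff_ne_empty, Ne, Finsupp.support_eq_empty, coeff_eq_zero]
    rintro rfl
    simp at hfg
  have hg : g.coeff.support.Nonempty := by
    rw [Finset.nonempty_iff_ne_empty, Ne, Finsupp.support_eq_empty, coeff_eq_zero]
    rintro rfl
    simp at hfg
  have key : ∀ a ∈ f.coeff.support, ∀ b ∈ g.coeff.support,
      UniqueAdd f.coeff.support g.coeff.support a b → a + b = 0 := by
    intro a ha b hb hu
    by_contra hne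
    have := coeff_mul_add_of_uniqueAdd hu
    rw [h, one_def, coeff_single, Finsupp.single_eq_of_ne hne] at this
    rw [Finsupp.mem_support_iff] at ha hb
    exact mul_ne_zero ha hb this.symm
  have hcard : f.coeff.support.card * g.coeff.support.card ≤ 1 := by
    by_contra! hlt
    obtain ⟨p1, h1, p2, h2, hne, hu1, hu2⟩ := TwoUniqueSums.uniqueAdd_of_one_lt_card hlt
    rw [Finset.mem_product] at h1 h2
    have e1 := key _ h1.1 _ h1.2 hu1
    have e2 := key _ h2.1 _ h2.2 hu2
    obtain ⟨e, e'⟩ := hu1 h2.1 h2.2 (e2.trans e1.symm)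
    exact hne (Prod.ext e e').symm
  have hf1 := hf.card_pos
  have hg1 := hg.card_pos
  obtain ⟨p, a, e⟩ := Finsupp.card_support_le_one'.1
    (show f.coeff.support.card ≤ 1 by nlinarith)
  refine ⟨p, a, ?_, coeff_injective e⟩
  rintro rfl
  rw [e] at hf
  simp at hf

end AddMonoidAlgebra

/-! ### The action of degrees on Laurent polynomials -/

namespace QWA

variable {k : Type*} [Field k] {n : ℕ}

theorem laurent_algHom_ext {B : Type*} [Semiring B] [Algebra k B] {f g : Laurent k n →ₐ[k] B}
    (h : ∀ m, f (AddMonoidAlgebra.single m 1) = g (AddMonoidAlgebra.single m 1)) : f = g := by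
  refine AlgHom.ext fun c => ?_
  induction c using AddMonoidAlgebra.induction_linear with
  | zero => simp
  | add a b ha hb => rw [map_add, map_add, ha, hb]
  | single m a =>
    have : (AddMonoidAlgebra.single m a : Laurent k n) = a • AddMonoidAlgebra.single m 1 := by simp
    rw [this, map_smul, map_smul, h]

/-- The character `h^m ↦ ∏ q_i^{p_i m_i}` by which `t^p` acts on monomials. -/
def pairing (q : Fin n → kˣ) (p m : Fin n → ℤ) : kˣ := ∏ i, q i ^ (p i * m i)

section pairing
variable (q : Fin n → kˣ)

theorem pairing_add_left (p p' m : Fin n → ℤ) :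
    pairing q (p + p') m = pairing q p m * pairing q p' m := by
  simp [pairing, add_mul, zpow_add, Finset.prod_mul_distrib]

theorem pairing_add_right (p m m' : Fin n → ℤ) :
    pairing q p (m + m') = pairing q p m * pairing q p m' := by
  simp [pairing, mul_add, zpow_add, Finset.prod_mul_distrib]

@[simp] theorem pairing_zero_left (m : Fin n → ℤ) : pairing q 0 m = 1 := by simp [pairing]

@[simp] theorem pairing_zero_right (p : Fin n → ℤ) : pairing q p 0 = 1 := by simp [pairing]

theorem pairing_single_left (i : Fin n) (c : ℤ) (m : Fin n → ℤ) :
    pairing q (Pi.single i c) m = q i ^ (c * m i) := by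
  rw [pairing, Finset.prod_eq_single i]
  · simp
  · intro j _ hj
    simp [hj]
  · simp

theorem pairing_single_right (p : Fin n → ℤ) (i : Fin n) (c : ℤ) :
    pairing q p (Pi.single i c) = q i ^ (p i * c) := by
  rw [pairing, Finset.prod_eq_single i]
  · simp
  · intro j _ hj
    simp [hj]
  · simp

end pairing

/-- The automorphism `∏ σ_i^{p_i}` of the Laurent polynomial ring. -/
def twist (q : Fin n → kˣ) (p : Fin n → ℤ) : Laurent k n →ₐ[k] Laurent k n :=
  AddMonoidAlgebra.lift k (Laurent k n) (Fin n → ℤ)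
    { toFun := fun m => AddMonoidAlgebra.single m.toAdd (pairing q p m.toAdd : k)
      map_one' := by simp [AddMonoidAlgebra.one_def]
      map_mul' := fun a b => by
        simp [AddMonoidAlgebra.single_mul_single, pairing_add_right] }

theorem twist_single (q : Fin n → kˣ) (p m : Fin n → ℤ) (a : k) :
    twist q p (AddMonoidAlgebra.single m a) =
      AddMonoidAlgebra.single m (a * (pairing q p m : k)) := by
  simp [twist, AddMonoidAlgebra.lift_single]

theorem sigma_eq_twist (q : Fin n → kˣ) (i : Fin n) : sigma q i = twist q (Pi.single i 1) := by
  refine laurent_algHom_ext fun m => ?_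
  rw [twist_single, pairing_single_left]
  simp [sigma, AddMonoidAlgebra.lift_single]

theorem twist_zero (q : Fin n → kˣ) : twist q 0 = AlgHom.id k _ := by
  refine laurent_algHom_ext fun m => ?_
  simp [twist_single]

theorem twist_add (q : Fin n → kˣ) (p p' : Fin n → ℤ) :
    twist q (p + p') = (twist q p).comp (twist q p') := by
  refine laurent_algHom_ext fun m => ?_
  simp [twist_single, pairing_add_left, mul_comm]

/-- The group `ℤⁿ` of degrees, acting on Laurent polynomials through `q`. -/
def Deg (_q : Fin n → kˣ) : Type := Multiplicative (Fin n → ℤ)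

instance (q : Fin n → kˣ) : CommGroup (Deg q) :=
  inferInstanceAs (CommGroup (Multiplicative (Fin n → ℤ)))

instance (q : Fin n → kˣ) : TwoUniqueProds (Deg q) :=
  inferInstanceAs (TwoUniqueProds (Multiplicative (Fin n → ℤ)))

/-- The degree `p ∈ ℤⁿ`. -/
def deg (q : Fin n → kˣ) : (Fin n → ℤ) ≃ Deg q := Multiplicative.ofAdd

theorem deg_add (q : Fin n → kˣ) (p p' : Fin n → ℤ) : deg q (p + p') = deg q p * deg q p' := rfl

theorem deg_zero (q : Fin n → kˣ) : deg q 0 = 1 := rfl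

theorem deg_neg (q : Fin n → kˣ) (p : Fin n → ℤ) : deg q (-p) = (deg q p)⁻¹ := rfl

/-- The action depends on `q`, so the group of degrees has to carry `q` as a parameter of its type.
-/
instance (q : Fin n → kˣ) : MulSemiringAction (Deg q) (Laurent k n) where
  smul p c := twist q ((deg q).symm p) c
  one_smul c := by
    change twist q 0 c = c
    rw [twist_zero]; rfl
  mul_smul p p' c := by
    change twist q ((deg q).symm p + (deg q).symm p') c = _
    rw [twist_add]; rfl
  smul_zero p := map_zero _
  smul_add p := map_add _
  smul_one p := map_one _
  smul_mul p := map_mul _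

theorem deg_smul (q : Fin n → kˣ) (p : Fin n → ℤ) (c : Laurent k n) :
    deg q p • c = twist q p c := rfl

instance (q : Fin n → kˣ) : SMulCommClass (Deg q) k (Laurent k n) where
  smul_comm p a c := map_smul (twist q ((deg q).symm p)) a c

/-- The quantum torus, the skew group algebra of `ℤⁿ` over the Laurent polynomials. -/
abbrev Torus (q : Fin n → kˣ) : Type _ := SkewMonoidAlgebra (Laurent k n) (Deg q)

/-! ### Homomorphisms out of the algebra given by generators and relations -/

section presentation

variable {d : ℕ} {q : Fin n → kˣ}

theorem X_mul_H (i : Fin n) : X d q i * H d q i = (q i : k) • ((H d q i : QWAlg d q) * X d q i) := by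
  have := mk_rel (Rel.x_h (d := d) (q := q) i)
  simp only [map_mul, map_smul] at this
  exact this

theorem Y_mul_H (i : Fin n) :
    Y d q i * H d q i = (((q i)⁻¹ : kˣ) : k) • ((H d q i : QWAlg d q) * Y d q i) := by
  have := mk_rel (Rel.y_h (d := d) (q := q) i)
  simp only [map_mul, map_smul] at this
  exact this

theorem X_mul_Y (i : Fin n) :
    X d q i * Y d q i = ((q i : k) • (H d q i : QWAlg d q)) ^ d - 1 := by
  have := mk_rel (Rel.x_y (d := d) (q := q) i)
  simp only [map_mul, map_smul, map_pow, map_sub, map_one] at this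
  exact this

theorem Y_mul_X (i : Fin n) : Y d q i * X d q i = (H d q i : QWAlg d q) ^ d - 1 := by
  have := mk_rel (Rel.y_x (d := d) (q := q) i)
  simp only [map_mul, map_pow, map_sub, map_one] at this
  exact this

theorem H_commute_X {i j : Fin n} (hij : i ≠ j) : Commute (H d q i : QWAlg d q) (X d q j) := by
  have := mk_rel (Rel.comm_h_x (d := d) (q := q) i j hij)
  simp only [map_mul] at this
  exact this

theorem H_commute_Y {i j : Fin n} (hij : i ≠ j) : Commute (H d q i : QWAlg d q) (Y d q j) := by
  have := mk_rel (Rel.comm_h_y (d := d) (q := q) i j hij)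
  simp only [map_mul] at this
  exact this

theorem X_commute_X (i j : Fin n) : Commute (X d q i) (X d q j) := by
  rcases eq_or_ne i j with rfl | hij
  · exact Commute.refl _
  have := mk_rel (Rel.comm_x_x (d := d) (q := q) i j hij)
  simp only [map_mul] at this
  exact this

theorem X_commute_Y {i j : Fin n} (hij : i ≠ j) : Commute (X d q i) (Y d q j) := by
  have := mk_rel (Rel.comm_x_y (d := d) (q := q) i j hij)
  simp only [map_mul] at this
  exact this

theorem Y_commute_Y (i j : Fin n) : Commute (Y d q i) (Y d q j) := by
  rcases eq_or_ne i j with rfl | hij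
  · exact Commute.refl _
  have := mk_rel (Rel.comm_y_y (d := d) (q := q) i j hij)
  simp only [map_mul] at this
  exact this

/-- Elements of a `k`-algebra that satisfy the defining relations of `A(n,d,q)`. -/
structure Realization (d : ℕ) (q : Fin n → kˣ) (R : Type*) [Ring R] [Algebra k R] where
  /-- The image of `x_i`. -/
  x : Fin n → R
  /-- The image of `y_i`. -/
  y : Fin n → R
  /-- The image of `h_i`. -/
  h : Fin n → Rˣ
  x_h : ∀ i, x i * h i = (q i : k) • ((h i : R) * x i)
  y_h : ∀ i, y i * h i = (((q i)⁻¹ : kˣ) : k) • ((h i : R) * y i)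
  x_y : ∀ i, x i * y i = ((q i : k) • (h i : R)) ^ d - 1
  y_x : ∀ i, y i * x i = (h i : R) ^ d - 1
  h_h : ∀ i j, i ≠ j → Commute (h i : R) (h j : R)
  h_x : ∀ i j, i ≠ j → Commute (h i : R) (x j)
  h_y : ∀ i j, i ≠ j → Commute (h i : R) (y j)
  x_x : ∀ i j, i ≠ j → Commute (x i) (x j)
  x_y_comm : ∀ i j, i ≠ j → Commute (x i) (y j)
  y_y : ∀ i j, i ≠ j → Commute (y i) (y j)

namespace Realization

variable {R : Type*} [Ring R] [Algebra k R] (D : Realization d q R)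

/-- The images of the generators. -/
def gen : Gen n → R
  | Gen.x i => D.x i
  | Gen.y i => D.y i
  | Gen.h i => D.h i
  | Gen.hInv i => ((D.h i)⁻¹ : Rˣ)

/-- The homomorphism given by a realization of the relations. -/
def lift : QWAlg d q →ₐ[k] R :=
  RingQuot.liftAlgHom k ⟨FreeAlgebra.lift k D.gen, by
    intro a b hab
    cases hab with
    | x_h i => simpa [gen] using D.x_h i
    | y_h i => simpa [gen] using D.y_h i
    | x_y i => simpa [gen] using D.x_y i
    | y_x i => simpa [gen] using D.y_x i
    | h_hInv i => simp [gen]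
    | hInv_h i => simp [gen]
    | comm_h_h i j hij => simpa [gen] using (D.h_h i j hij).eq
    | comm_h_x i j hij => simpa [gen] using (D.h_x i j hij).eq
    | comm_h_y i j hij => simpa [gen] using (D.h_y i j hij).eq
    | comm_x_x i j hij => simpa [gen] using (D.x_x i j hij).eq
    | comm_x_y i j hij => simpa [gen] using (D.x_y_comm i j hij).eq
    | comm_y_y i j hij => simpa [gen] using (D.y_y i j hij).eq⟩

theorem lift_mk (a : FreeAlgebra k (Gen n)) : D.lift (QWA.mk d q a) = FreeAlgebra.lift k D.gen a :=
  RingQuot.liftAlgHom_mkAlgHom_apply _ _ _ _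

@[simp] theorem lift_X (i : Fin n) : D.lift (X d q i) = D.x i := by
  rw [X, lift_mk, FreeAlgebra.lift_ι_apply]; rfl

@[simp] theorem lift_Y (i : Fin n) : D.lift (Y d q i) = D.y i := by
  rw [Y, lift_mk, FreeAlgebra.lift_ι_apply]; rfl

@[simp] theorem lift_H (i : Fin n) : D.lift (H d q i : QWAlg d q) = D.h i := by
  rw [H, lift_mk, FreeAlgebra.lift_ι_apply]; rfl

end Realization

theorem mk_surjective : Function.Surjective (mk d q) := RingQuot.mkAlgHom_surjective k _

/-- Serves as the induction principle for A: a property closed under sums and products is tested on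
generators. The inverses `h_i⁻¹` are listed because a subalgebra need not contain them. -/
theorem subalgebra_eq_top (S : Subalgebra k (QWAlg d q)) (hX : ∀ i, X d q i ∈ S)
    (hY : ∀ i, Y d q i ∈ S) (hH : ∀ i, (H d q i : QWAlg d q) ∈ S)
    (hH' : ∀ i, (((H d q i)⁻¹ : (QWAlg d q)ˣ) : QWAlg d q) ∈ S) : S = ⊤ := by
  rw [eq_top_iff]
  rintro a -
  obtain ⟨a, rfl⟩ := mk_surjective a
  induction a using FreeAlgebra.induction with
  | grade0 r => rw [AlgHom.commutes]; exact S.algebraMap_mem r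
  | grade1 g =>
    cases g with
    | x i => exact hX i
    | y i => exact hY i
    | h i => exact hH i
    | hInv i => exact hH' i
  | mul a b ha hb => rw [map_mul]; exact S.mul_mem ha hb
  | add a b ha hb => rw [map_add]; exact S.add_mem ha hb

theorem map_inv_eq_of_map_eq {A B : Type*} [Ring A] [Ring B] [Algebra k A] [Algebra k B]
    {f g : A →ₐ[k] B} {u : Aˣ} (h : f u = g u) : f (u⁻¹ : Aˣ) = g (u⁻¹ : Aˣ) := by
  have : Units.map (f : A →* B) u = Units.map (g : A →* B) u := Units.ext h
  have := congrArg (fun v : Bˣ => ((v⁻¹ : Bˣ) : B)) this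
  simpa [← map_inv] using this

theorem algHom_ext {R : Type*} [Ring R] [Algebra k R] {f g : QWAlg d q →ₐ[k] R}
    (hX : ∀ i, f (X d q i) = g (X d q i)) (hY : ∀ i, f (Y d q i) = g (Y d q i))
    (hH : ∀ i, f (H d q i : QWAlg d q) = g (H d q i : QWAlg d q)) : f = g := by
  have := subalgebra_eq_top (AlgHom.equalizer f g) hX hY hH
    (fun i => map_inv_eq_of_map_eq (hH i))
  exact AlgHom.ext fun a => (this.ge trivial : a ∈ AlgHom.equalizer f g)

end presentation

/-! ### Generation of the Laurent polynomial ring -/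

section laurent

theorem addSubmonoid_eq_top (T : AddSubmonoid (Fin n → ℤ)) (h : ∀ i, Pi.single i 1 ∈ T)
    (h' : ∀ i, -Pi.single i 1 ∈ T) : T = ⊤ := by
  rw [eq_top_iff]
  rintro m -
  rw [← Finset.univ_sum_single m]
  refine T.sum_mem fun i _ => ?_
  obtain ⟨s, hs | hs⟩ := (m i).eq_nat_or_neg
  · rw [hs, show (Pi.single i (s : ℤ) : Fin n → ℤ) = s • Pi.single i 1 by
      rw [← Pi.single_smul]; simp]
    exact T.nsmul_mem (h i) s
  · rw [hs, show (Pi.single i (-(s : ℤ)) : Fin n → ℤ) = s • -Pi.single i 1 by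
      rw [← Pi.single_neg, ← Pi.single_smul]; simp]
    exact T.nsmul_mem (h' i) s

theorem laurent_subalgebra_eq_top (S : Subalgebra k (Laurent k n))
    (h : ∀ i, AddMonoidAlgebra.single (Pi.single i 1) 1 ∈ S)
    (h' : ∀ i, AddMonoidAlgebra.single (-Pi.single i 1) 1 ∈ S) : S = ⊤ := by
  let T : AddSubmonoid (Fin n → ℤ) :=
    { carrier := {m | AddMonoidAlgebra.single m 1 ∈ S}
      zero_mem' := by
        change AddMonoidAlgebra.single 0 1 ∈ S
        rw [← AddMonoidAlgebra.one_def]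
        exact S.one_mem
      add_mem' := fun {a b} ha hb => by
        have := S.mul_mem ha hb
        rwa [AddMonoidAlgebra.single_mul_single, mul_one] at this }
  have hT : T = ⊤ := addSubmonoid_eq_top T h h'
  rw [eq_top_iff]
  rintro c -
  induction c using AddMonoidAlgebra.induction_linear with
  | zero => exact S.zero_mem
  | add a b ha hb => exact S.add_mem ha hb
  | single m a =>
    have : (AddMonoidAlgebra.single m a : Laurent k n) = a • AddMonoidAlgebra.single m 1 := by simp
    rw [this]
    exact S.smul_mem (hT.ge trivial : m ∈ T) a

end laurent

/-! ### Monomials in the `h_i` and their commutation rules -/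

section hPow

variable (d : ℕ) (q : Fin n → kˣ)

theorem hPow_single (i : Fin n) : hPow d q (Pi.single i 1) = H d q i := by
  classical
  have h1 := Finset.mul_noncommProd_erase Finset.univ (Finset.mem_univ i)
    (fun j => H d q j ^ (Pi.single i 1 : Fin n → ℤ) j) (H_zpow_pairwise d q _)
  have h2 := Finset.noncommProd_eq_pow_card (Finset.univ.erase i)
    (fun j => H d q j ^ (Pi.single i 1 : Fin n → ℤ) j)
    (fun a _ b _ _ => (H_commute d q a b).zpow_zpow _ _) 1
    (fun j hj => by simp [Finset.ne_of_mem_erase hj])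
  rw [h2, one_pow, mul_one] at h1
  exact h1.symm.trans (by simp)

theorem hPow_neg (m : Fin n → ℤ) : hPow d q (-m) = (hPow d q m)⁻¹ := by
  rw [eq_inv_iff_mul_eq_one, ← hPow_add, neg_add_cancel, hPow_zero]

theorem hPow_smul (c : ℤ) (m : Fin n → ℤ) : hPow d q (c • m) = hPow d q m ^ c := by
  let f : Multiplicative (Fin n → ℤ) →* (QWAlg d q)ˣ :=
    { toFun := fun m => hPow d q m.toAdd
      map_one' := hPow_zero d q
      map_mul' := fun a b => hPow_add d q _ _ }
  exact map_zpow f (Multiplicative.ofAdd m) c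

theorem ofLaurent_single (m : Fin n → ℤ) (a : k) :
    ofLaurent d q (AddMonoidAlgebra.single m a) = a • (hPow d q m : QWAlg d q) := by
  simp [ofLaurent, AddMonoidAlgebra.lift_single]

theorem ofLaurent_single_one (i : Fin n) :
    ofLaurent d q (AddMonoidAlgebra.single (Pi.single i 1) 1) = H d q i := by
  rw [ofLaurent_single, one_smul, hPow_single]

theorem H_pow_eq_ofLaurent (i : Fin n) (a : k) (s : ℕ) :
    (a • (H d q i : QWAlg d q)) ^ s =
      ofLaurent d q (AddMonoidAlgebra.single (Pi.single i (s : ℤ)) (a ^ s)) := by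
  rw [← hPow_single, ← ofLaurent_single, ← map_pow, AddMonoidAlgebra.single_pow]
  congr 2
  rw [← Pi.single_smul]; simp

/-- Commutation of an element with monomials follows from commutation with the `h_j`. -/
theorem mul_ofLaurent_of_H {a : QWAlg d q} {p : Fin n → ℤ}
    (h : ∀ j, a * H d q j =
      (pairing q p (Pi.single j 1) : k) • ((H d q j : QWAlg d q) * a)) (c : Laurent k n) :
    a * ofLaurent d q c = ofLaurent d q (twist q p c) * a := by
  let S : Subalgebra k (Laurent k n) :=
    { carrier := {c | a * ofLaurent d q c = ofLaurent d q (twist q p c) * a}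
      mul_mem' := fun {b c} hb hc => by
        simp only [Set.mem_ofPred_eq, map_mul] at *
        rw [← mul_assoc, hb, mul_assoc, hc, mul_assoc]
      add_mem' := fun {b c} hb hc => by
        simp only [Set.mem_ofPred_eq, map_add] at *
        rw [mul_add, add_mul, hb, hc]
      algebraMap_mem' := fun r => by
        simp only [Set.mem_ofPred_eq, AlgHom.commutes]
        exact (Algebra.commutes r a).symm }
  have h1 : ∀ i, AddMonoidAlgebra.single (Pi.single i 1) 1 ∈ S := fun i => by
    change a * ofLaurent d q _ = _
    rw [twist_single, ofLaurent_single, ofLaurent_single, hPow_single, one_smul, one_mul, h,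
      smul_mul_assoc]
  have h2 : ∀ i, AddMonoidAlgebra.single (-Pi.single i 1) 1 ∈ S := fun i => by
    have e := h1 i
    change a * ofLaurent d q _ = ofLaurent d q _ * a at e
    change a * ofLaurent d q _ = ofLaurent d q _ * a
    set u : Laurent k n := AddMonoidAlgebra.single (Pi.single i 1) 1
    set v : Laurent k n := AddMonoidAlgebra.single (-Pi.single i 1) 1
    have huv : u * v = 1 := by
      simp [u, v, AddMonoidAlgebra.single_mul_single, AddMonoidAlgebra.one_def]
    have hvu : v * u = 1 := by rw [mul_comm, huv]
    -- The rule for `u` implies the rule for its inverse `v`: insert `twist v * twist u = 1` on the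
    -- left, use the rule for `u`, and cancel `u * v`.
    calc a * ofLaurent d q v
        = ofLaurent d q (twist q p v) * (ofLaurent d q (twist q p u) * a) * ofLaurent d q v := by
          rw [← mul_assoc (ofLaurent d q (twist q p v)), ← map_mul, ← map_mul, hvu, map_one,
            map_one, one_mul]
      _ = ofLaurent d q (twist q p v) * a := by
          rw [← e, mul_assoc, mul_assoc, ← map_mul, huv, map_one, mul_one]
  exact ((laurent_subalgebra_eq_top S h1 h2).ge trivial : c ∈ S)

theorem X_mul_ofLaurent (i : Fin n) (c : Laurent k n) :
    X d q i * ofLaurent d q c = ofLaurent d q (twist q (Pi.single i 1) c) * X d q i := by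
  refine mul_ofLaurent_of_H d q (fun j => ?_) c
  rw [pairing_single_right]
  rcases eq_or_ne i j with rfl | hij
  · simpa using X_mul_H (d := d) (q := q) i
  · simpa [hij.symm] using (H_commute_X (d := d) (q := q) hij.symm).eq.symm

theorem Y_mul_ofLaurent (i : Fin n) (c : Laurent k n) :
    Y d q i * ofLaurent d q c = ofLaurent d q (twist q (-Pi.single i 1) c) * Y d q i := by
  refine mul_ofLaurent_of_H d q (fun j => ?_) c
  rw [pairing_single_right]
  rcases eq_or_ne i j with rfl | hij
  · simpa using Y_mul_H (d := d) (q := q) i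
  · simpa [hij.symm] using (H_commute_Y (d := d) (q := q) hij.symm).eq.symm

end hPow

/-! ### The map to the quantum torus -/

section torus

/-- The Laurent polynomial `c h_j^d - 1`. -/
def binom (n : ℕ) (d : ℕ) (j : Fin n) (c : k) : Laurent k n :=
  AddMonoidAlgebra.single (Pi.single j (d : ℤ)) c - 1

theorem twist_binom (d : ℕ) (q : Fin n → kˣ) (p : Fin n → ℤ) (j : Fin n) (c : k) :
    twist q p (binom n d j c) = binom n d j (c * ((q j ^ (p j * d) : kˣ) : k)) := by
  rw [binom, map_sub, map_one, twist_single, pairing_single_right, binom]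

theorem single_one_pow (d : ℕ) (j : Fin n) (c : k) :
    (AddMonoidAlgebra.single (Pi.single j 1) c : Laurent k n) ^ d - 1 =
      binom n d j (c ^ d) := by
  rw [binom, AddMonoidAlgebra.single_pow, ← Pi.single_smul]; simp

theorem binom_ne_zero {d : ℕ} (hd : 0 < d) (j : Fin n) (c : k) : binom n d j c ≠ 0 := by
  intro h
  have := congrArg (fun f => AddMonoidAlgebra.coeff f 0) h
  rw [binom, AddMonoidAlgebra.one_def] at this
  have h0 : (Pi.single j (d : ℤ) : Fin n → ℤ) ≠ 0 := by simp [hd.ne']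
  simp [h0] at this

/-- The inclusion of the Laurent polynomials into the quantum torus. -/
def coeffHom (q : Fin n → kˣ) : Laurent k n →ₐ[k] Torus q :=
  { SkewMonoidAlgebra.singleOneRingHom with
    commutes' := fun _ => rfl }

theorem coeffHom_apply (q : Fin n → kˣ) (c : Laurent k n) :
    coeffHom q c = SkewMonoidAlgebra.single 1 c := rfl

/-- The monomial `h^m` as a unit of the Laurent polynomial ring. -/
def monomial (k : Type*) [Field k] (m : Fin n → ℤ) : (Laurent k n)ˣ where
  val := AddMonoidAlgebra.single m 1
  inv := AddMonoidAlgebra.single (-m) 1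
  val_inv := by simp [AddMonoidAlgebra.single_mul_single, AddMonoidAlgebra.one_def]
  inv_val := by simp [AddMonoidAlgebra.single_mul_single, AddMonoidAlgebra.one_def]

theorem coe_single_mul (q : Fin n → kˣ) (p p' : Fin n → ℤ) (a b : Laurent k n) :
    (SkewMonoidAlgebra.single (deg q p) a * SkewMonoidAlgebra.single (deg q p') b : Torus q) =
      SkewMonoidAlgebra.single (deg q (p + p')) (a * twist q p b) := by
  rw [SkewMonoidAlgebra.single_mul_single, deg_add, deg_smul]

theorem single_mul_coeffHom (q : Fin n → kˣ) (p : Fin n → ℤ) (a b : Laurent k n) :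
    (SkewMonoidAlgebra.single (deg q p) a * coeffHom q b : Torus q) =
      SkewMonoidAlgebra.single (deg q p) (a * twist q p b) := by
  rw [coeffHom_apply, ← deg_zero, coe_single_mul, add_zero]

theorem coeffHom_mul_single (q : Fin n → kˣ) (p : Fin n → ℤ) (a b : Laurent k n) :
    (coeffHom q a * SkewMonoidAlgebra.single (deg q p) b : Torus q) =
      SkewMonoidAlgebra.single (deg q p) (a * b) := by
  rw [coeffHom_apply, ← deg_zero, coe_single_mul, zero_add, twist_zero]; rfl

theorem smul_single_deg (q : Fin n → kˣ) (r : k) (p : Fin n → ℤ) (a : Laurent k n) :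
    (r • SkewMonoidAlgebra.single (deg q p) a : Torus q) =
      SkewMonoidAlgebra.single (deg q p) (r • a) := SkewMonoidAlgebra.smul_single _ _ _

variable (d : ℕ) (q : Fin n → kˣ)

/-- The elements `t_i`, `(h_i^d - 1) t_i⁻¹` and `h_i` of the quantum torus satisfy the relations
of `A(n,d,q)`. -/
def torusRealization : Realization d q (Torus q) where
  x i := SkewMonoidAlgebra.single (deg q (Pi.single i 1)) 1
  y i := SkewMonoidAlgebra.single (deg q (-Pi.single i 1)) (binom n d i 1)
  h i := Units.map (coeffHom q : Laurent k n →* Torus q) (monomial k (Pi.single i 1))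
  x_h i := by
    change _ * coeffHom q (AddMonoidAlgebra.single _ _) =
      _ • (coeffHom q (AddMonoidAlgebra.single _ _) * _)
    rw [single_mul_coeffHom, coeffHom_mul_single, twist_single, pairing_single_right,
      smul_single_deg]
    simp
  y_h i := by
    change _ * coeffHom q (AddMonoidAlgebra.single _ _) =
      _ • (coeffHom q (AddMonoidAlgebra.single _ _) * _)
    rw [single_mul_coeffHom, coeffHom_mul_single, twist_single, pairing_single_right,
      smul_single_deg, mul_comm, ← smul_mul_assoc]
    simp
  x_y i := by
    -- Moving `t_i` past `h_i^d - 1` twists it into `q_i^d h_i^d - 1`.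
    change _ = (_ • coeffHom q (AddMonoidAlgebra.single _ _)) ^ d - 1
    rw [coe_single_mul, add_neg_cancel, deg_zero, ← coeffHom_apply, twist_binom, ← map_smul,
      ← map_pow, ← map_one (coeffHom q), ← map_sub, AddMonoidAlgebra.smul_single, single_one_pow]
    simp
  y_x i := by
    change _ = (coeffHom q (AddMonoidAlgebra.single _ _)) ^ d - 1
    rw [coe_single_mul, neg_add_cancel, deg_zero, ← coeffHom_apply, map_one, mul_one,
      ← map_pow, ← map_one (coeffHom q), ← map_sub, single_one_pow]
    simp
  h_h i j _ := by
    change coeffHom q _ * coeffHom q _ = coeffHom q _ * coeffHom q _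
    rw [← map_mul, ← map_mul, mul_comm]
  h_x i j hij := by
    change coeffHom q (AddMonoidAlgebra.single _ _) * _ =
      _ * coeffHom q (AddMonoidAlgebra.single _ _)
    rw [single_mul_coeffHom, coeffHom_mul_single, twist_single, pairing_single_right]
    simp [hij]
  h_y i j hij := by
    change coeffHom q (AddMonoidAlgebra.single _ _) * _ =
      _ * coeffHom q (AddMonoidAlgebra.single _ _)
    rw [single_mul_coeffHom, coeffHom_mul_single, twist_single, pairing_single_right, mul_comm]
    simp [hij]
  x_x i j _ := by
    rw [Commute, SemiconjBy, coe_single_mul, coe_single_mul, add_comm, map_one, map_one]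
  x_y_comm i j hij := by
    rw [Commute, SemiconjBy, coe_single_mul, coe_single_mul, add_comm, map_one, twist_binom]
    simp [hij.symm]
  y_y i j hij := by
    rw [Commute, SemiconjBy, coe_single_mul, coe_single_mul, add_comm, twist_binom, twist_binom,
      mul_comm]
    simp [hij, hij.symm]

/-- The embedding of `A(n,d,q)` into the quantum torus. -/
def toTorus : QWAlg d q →ₐ[k] Torus q := (torusRealization d q).lift

theorem toTorus_X (i : Fin n) :
    toTorus d q (X d q i) = SkewMonoidAlgebra.single (deg q (Pi.single i 1)) 1 :=
  (torusRealization d q).lift_X i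

theorem toTorus_Y (i : Fin n) :
    toTorus d q (Y d q i) = SkewMonoidAlgebra.single (deg q (-Pi.single i 1)) (binom n d i 1) :=
  (torusRealization d q).lift_Y i

theorem toTorus_H (i : Fin n) :
    toTorus d q (H d q i : QWAlg d q) =
      coeffHom q (AddMonoidAlgebra.single (Pi.single i 1) 1) :=
  (torusRealization d q).lift_H i

theorem toTorus_ofLaurent (c : Laurent k n) :
    toTorus d q (ofLaurent d q c) = coeffHom q c := by
  let f := (toTorus d q).comp (ofLaurent d q)
  have h : ∀ i, f (AddMonoidAlgebra.single (Pi.single i 1) 1) =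
      coeffHom q (AddMonoidAlgebra.single (Pi.single i 1) 1) := fun i => by
    rw [← toTorus_H d q, ← ofLaurent_single_one]; rfl
  have := laurent_subalgebra_eq_top (AlgHom.equalizer f (coeffHom q)) h
    (fun i => map_inv_eq_of_map_eq (u := monomial k (Pi.single i 1)) (h i))
  exact (this.ge trivial : c ∈ AlgHom.equalizer f (coeffHom q))

end torus

/-! ### Spanning by monomials in the `x_i` and `y_i` -/

section spanning

variable (d : ℕ) (q : Fin n → kˣ)

/-- `x_i^p` if `p ≥ 0` and `y_i^{-p}` if `p < 0`. -/
def xyPow (i : Fin n) : ℤ → QWAlg d q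
  | Int.ofNat s => X d q i ^ s
  | Int.negSucc s => Y d q i ^ (s + 1)

theorem xyPow_pairwise (p : Fin n → ℤ) (s : Finset (Fin n)) :
    (s : Set (Fin n)).Pairwise (Function.onFun Commute fun i => xyPow d q i (p i)) := by
  intro i _ j _ hij
  change Commute (xyPow d q i (p i)) (xyPow d q j (p j))
  rcases p i with s | s <;> rcases p j with t | t
  · exact (X_commute_X i j).pow_pow _ _
  · exact (X_commute_Y hij).pow_pow _ _
  · exact (X_commute_Y hij.symm).symm.pow_pow _ _
  · exact (Y_commute_Y i j).pow_pow _ _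

/-- The monomial of degree `p` in the `x_i` and `y_i`. -/
def xyMonomial (p : Fin n → ℤ) : QWAlg d q :=
  Finset.univ.noncommProd (fun i => xyPow d q i (p i)) (xyPow_pairwise d q p _)

theorem X_mul_Y_eq_ofLaurent (i : Fin n) : X d q i * Y d q i =
    ofLaurent d q (binom n d i ((q i : k) ^ d)) := by
  rw [X_mul_Y, H_pow_eq_ofLaurent, binom, map_sub, map_one]

theorem Y_mul_X_eq_ofLaurent (i : Fin n) : Y d q i * X d q i =
    ofLaurent d q (binom n d i 1) := by
  have := H_pow_eq_ofLaurent d q i 1 d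
  rw [one_smul, one_pow] at this
  rw [Y_mul_X, this, binom, map_sub, map_one]

/-- Either `x_i` lengthens a power of `x_i`, or it cancels one `y_i` at the cost of the Laurent
coefficient `x_i y_i`. The same dichotomy governs multiplication by `y_i`. -/
theorem exists_X_mul_xyPow (i : Fin n) (p : ℤ) :
    ∃ c, X d q i * xyPow d q i p = ofLaurent d q c * xyPow d q i (p + 1) := by
  rcases p with s | s
  · refine ⟨1, ?_⟩
    rw [map_one, one_mul]
    exact (pow_succ' _ _).symm
  · refine ⟨binom n d i ((q i : k) ^ d), ?_⟩
    rw [← X_mul_Y_eq_ofLaurent, xyPow, pow_succ', ← mul_assoc]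
    congr 1
    rcases s with _ | s
    · exact (pow_zero _).trans (pow_zero _).symm
    · rw [show Int.negSucc (s + 1) + 1 = Int.negSucc s by omega]; rfl

theorem exists_Y_mul_xyPow (i : Fin n) (p : ℤ) :
    ∃ c, Y d q i * xyPow d q i p = ofLaurent d q c * xyPow d q i (p - 1) := by
  rcases p with s | s
  · rcases s with _ | s
    · refine ⟨1, ?_⟩
      rw [map_one, one_mul]
      change Y d q i * X d q i ^ 0 = Y d q i ^ (0 + 1)
      simp
    · refine ⟨binom n d i 1, ?_⟩
      rw [← Y_mul_X_eq_ofLaurent,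
        show Int.ofNat (s + 1) - 1 = Int.ofNat s by simp, xyPow, xyPow, pow_succ',
        ← mul_assoc]
  · refine ⟨1, ?_⟩
    rw [map_one, one_mul, show Int.negSucc s - 1 = Int.negSucc (s + 1) by omega]
    exact (pow_succ' _ _).symm

/-- The powers at different indices commute, so the one at `i` can be brought to the front, where
`a` acts on it alone. -/
theorem mul_xyMonomial {a : QWAlg d q} {i : Fin n} {e : ℤ}
    (h : ∀ p, ∃ c, a * xyPow d q i p = ofLaurent d q c * xyPow d q i (p + e)) (p : Fin n → ℤ) :
    ∃ c, a * xyMonomial d q p = ofLaurent d q c * xyMonomial d q (p + Pi.single i e) := by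
  classical
  have key : ∀ r, xyMonomial d q r = xyPow d q i (r i) *
      (Finset.univ.erase i).noncommProd (fun i => xyPow d q i (r i)) (xyPow_pairwise d q r _) :=
    fun r => (Finset.mul_noncommProd_erase Finset.univ (Finset.mem_univ i)
      (fun i => xyPow d q i (r i)) (xyPow_pairwise d q r _)).symm
  obtain ⟨c, hc⟩ := h (p i)
  refine ⟨c, ?_⟩
  rw [key p, key, ← mul_assoc, ← mul_assoc, hc]
  congr 1
  · simp
  · refine Finset.noncommProd_congr rfl (fun j hj => ?_) _
    simp [Finset.ne_of_mem_erase hj]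

/-- The linear map `(c_p)_p ↦ ∑ c_p z^p`, with `z^p` the monomials in the `x_i` and `y_i`. -/
def combination : ((Fin n → ℤ) →₀ Laurent k n) →ₗ[k] QWAlg d q :=
  Finsupp.lsum k fun p => (LinearMap.mulRight k (xyMonomial d q p)).comp (ofLaurent d q).toLinearMap

theorem combination_single (p : Fin n → ℤ) (c : Laurent k n) :
    combination d q (Finsupp.single p c) = ofLaurent d q c * xyMonomial d q p := by
  simp [combination]

theorem mul_mem_range_combination {a : QWAlg d q} {e : Fin n → ℤ}
    (h : ∀ c, a * ofLaurent d q c = ofLaurent d q (twist q e c) * a)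
    (h' : ∀ p, ∃ c, a * xyMonomial d q p = ofLaurent d q c * xyMonomial d q (p + e))
    {b : QWAlg d q} (hb : b ∈ LinearMap.range (combination d q)) :
    a * b ∈ LinearMap.range (combination d q) := by
  obtain ⟨F, rfl⟩ := hb
  induction F using Finsupp.induction_linear with
  | zero => simp
  | add f g hf hg => rw [map_add, mul_add]; exact Submodule.add_mem _ hf hg
  | single p c =>
    obtain ⟨c', hc'⟩ := h' p
    refine ⟨Finsupp.single (p + e) (twist q e c * c'), ?_⟩
    rw [combination_single, combination_single, ← mul_assoc, h, mul_assoc, hc', map_mul, mul_assoc]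

/-- The elements whose left multiplication preserves the range form a subalgebra containing all
generators, and the range contains 1. -/
theorem combination_surjective : Function.Surjective (combination d q) := by
  let R := LinearMap.range (combination d q)
  let S : Subalgebra k (QWAlg d q) :=
    { carrier := {a | ∀ b ∈ R, a * b ∈ R}
      mul_mem' := fun {a a'} ha ha' b hb => by rw [mul_assoc]; exact ha _ (ha' _ hb)
      add_mem' := fun {a a'} ha ha' b hb => by
        rw [add_mul]; exact R.add_mem (ha _ hb) (ha' _ hb)
      algebraMap_mem' := fun r b hb => by
        rw [← Algebra.smul_def]; exact R.smul_mem r hb }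
  have hL : ∀ c, ofLaurent d q c ∈ S := fun c b hb => by
    refine mul_mem_range_combination (e := 0) d q (fun c' => ?_) (fun p => ?_) hb
    · rw [twist_zero, ← map_mul, mul_comm, map_mul]; rfl
    · exact ⟨c, by rw [add_zero]⟩
  have hS : S = ⊤ := by
    refine subalgebra_eq_top S (fun i b hb => ?_) (fun i b hb => ?_) (fun i => ?_) (fun i => ?_)
    · exact mul_mem_range_combination d q (X_mul_ofLaurent d q i)
        (mul_xyMonomial d q (exists_X_mul_xyPow d q i)) hb
    · refine mul_mem_range_combination d q (e := Pi.single i (-1)) (fun c => ?_)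
        (mul_xyMonomial d q (exists_Y_mul_xyPow d q i)) hb
      rw [Y_mul_ofLaurent, Pi.single_neg]
    · rw [← ofLaurent_single_one]
      exact hL _
    · rw [← hPow_single, ← hPow_neg, ← one_smul k (Units.val _), ← ofLaurent_single]
      exact hL _
  have h1 : (1 : QWAlg d q) ∈ R := ⟨Finsupp.single 0 1, by
    rw [combination_single, map_one, one_mul]
    refine (Finset.noncommProd_eq_pow_card _ _ _ 1 fun i _ => ?_).trans (one_pow _)
    exact pow_zero _⟩
  intro a
  have := (hS.ge trivial : a ∈ S) 1 h1
  rwa [mul_one] at this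

end spanning

/-! ### The embedding into the quantum torus -/

section injectivity

variable {d : ℕ} (q : Fin n → kˣ)

/-- Nonzero homogeneous elements of degree `p` in the quantum torus. -/
def IsHomog (p : Fin n → ℤ) (b : Torus q) : Prop :=
  ∃ c, c ≠ 0 ∧ b = SkewMonoidAlgebra.single (deg q p) c

variable {q}

theorem isHomog_one : IsHomog q 0 1 := ⟨1, one_ne_zero, rfl⟩

theorem IsHomog.mul {p p' : Fin n → ℤ} {b b' : Torus q} (h : IsHomog q p b)
    (h' : IsHomog q p' b') : IsHomog q (p + p') (b * b') := by
  obtain ⟨c, hc, rfl⟩ := h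
  obtain ⟨c', hc', rfl⟩ := h'
  refine ⟨c * twist q p c', mul_ne_zero hc ?_, coe_single_mul _ _ _ _ _⟩
  rw [← deg_smul]
  exact (smul_ne_zero_iff_ne _).2 hc'

theorem IsHomog.pow {p : Fin n → ℤ} {b : Torus q} (h : IsHomog q p b) (s : ℕ) :
    IsHomog q (s • p) (b ^ s) := by
  induction s with
  | zero => simpa using isHomog_one
  | succ s ih => rw [pow_succ, succ_nsmul]; exact ih.mul h

theorem isHomog_X (i : Fin n) : IsHomog q (Pi.single i 1) (toTorus d q (X d q i)) :=
  ⟨1, one_ne_zero, toTorus_X d q i⟩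

theorem isHomog_Y (hd : 0 < d) (i : Fin n) :
    IsHomog q (-Pi.single i 1) (toTorus d q (Y d q i)) :=
  ⟨_, binom_ne_zero hd i 1, toTorus_Y d q i⟩

theorem isHomog_xyPow (hd : 0 < d) (i : Fin n) (p : ℤ) :
    IsHomog q (Pi.single i p) (toTorus d q (xyPow d q i p)) := by
  rcases p with s | s
  · have := (isHomog_X (d := d) (q := q) i).pow s
    rw [← map_pow, ← Pi.single_smul, nsmul_one] at this
    exact this
  · have := (isHomog_Y (d := d) (q := q) hd i).pow (s + 1)
    rw [← map_pow, ← Pi.single_neg, ← Pi.single_smul,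
      show (s + 1) • (-1 : ℤ) = Int.negSucc s by simp [Int.negSucc_eq]] at this
    exact this

theorem isHomog_xyMonomial (hd : 0 < d) (p : Fin n → ℤ) :
    IsHomog q p (toTorus d q (xyMonomial d q p)) := by
  classical
  have key : ∀ s : Finset (Fin n), IsHomog q (∑ i ∈ s, Pi.single i (p i))
      (toTorus d q (s.noncommProd (fun i => xyPow d q i (p i)) (xyPow_pairwise d q p _))) := by
    intro s
    induction s using Finset.induction_on with
    | empty => simpa using isHomog_one
    | insert i s hi ih =>
      rw [Finset.noncommProd_insert_of_notMem _ _ _ _ hi, map_mul, Finset.sum_insert hi]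
      exact (isHomog_xyPow hd i (p i)).mul ih
  have := key Finset.univ
  rwa [Finset.univ_sum_single] at this

/-- The spanning monomials have nonzero homogeneous images of pairwise distinct degrees. As L is a
domain, each coefficient of a combination can be read off in its own degree. -/
theorem toTorus_injective (hd : 0 < d) : Function.Injective (toTorus d q) := by
  choose c hc hz using fun p => isHomog_xyMonomial (d := d) (q := q) hd p
  have key : ∀ F p, (toTorus d q (combination d q F)).coeff (deg q p) = F p * c p := by
    intro F p
    induction F using Finsupp.induction_linear with
    | zero => simp
    | add f g hf hg => simp [hf, hg, add_mul]
    | single r a =>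
      rw [combination_single, map_mul, toTorus_ofLaurent, hz, coeffHom_mul_single,
        SkewMonoidAlgebra.coeff_single]
      rcases eq_or_ne r p with rfl | hrp
      · simp
      · rw [Finsupp.single_eq_of_ne hrp.symm,
          Finsupp.single_eq_of_ne fun h => hrp ((deg q).injective h).symm, zero_mul]
  rw [injective_iff_map_eq_zero]
  intro a ha
  obtain ⟨F, rfl⟩ := combination_surjective d q a
  have : F = 0 := by
    ext1 p
    have := key F p
    rw [ha] at this
    simpa [hc p] using this.symm
  rw [this, map_zero]

theorem ofLaurent_injective : Function.Injective (ofLaurent d q) := by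
  intro a b h
  have := congrArg (toTorus d q) h
  rw [toTorus_ofLaurent, toTorus_ofLaurent] at this
  exact SkewMonoidAlgebra.single_injective _ this

end injectivity

/-! ### Divisibility of coefficients in negative degrees -/

section divisibility

variable {d : ℕ} {q : Fin n → kˣ}

/-- In the image of `A(n,d,q)`, the coefficients of degree `p` with `p_j < 0` are divisible by
`q_j^{d(1+p_j)} h_j^d - 1`. -/
theorem binom_dvd_coeff (j : Fin n) (a : QWAlg d q) (p : Fin n → ℤ) (hp : p j < 0) :
    binom n d j ((q j ^ ((1 + p j) * d) : kˣ) : k) ∣ (toTorus d q a).coeff (deg q p) := by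
  -- The coefficient of `y_j^s` is a product of `s` binomials, but only the one with the extreme
  -- power of `q_j` is recorded: left multiplication in degree `e` moves degree `p - e` to `p` and
  -- twists the recorded binomial at `p - e` exactly into the one at `p`. Hence the left
  -- multiplications that preserve `N` include those by all generators.
  let N : Submodule k (Torus q) :=
    { carrier := {b | ∀ p : Fin n → ℤ, p j < 0 →
        binom n d j ((q j ^ ((1 + p j) * d) : kˣ) : k) ∣ b.coeff (deg q p)}
      zero_mem' := fun p _ => dvd_zero _
      add_mem' := fun {b b'} hb hb' p hp => by
        rw [SkewMonoidAlgebra.coeff_add]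
        exact dvd_add (hb p hp) (hb' p hp)
      smul_mem' := fun r b hb p hp => by
        change _ ∣ r • b.coeff (deg q p)
        rw [Algebra.smul_def]
        exact (hb p hp).mul_left _ }
  let S : Subalgebra k (QWAlg d q) :=
    { carrier := {a | ∀ b ∈ N, toTorus d q a * b ∈ N}
      mul_mem' := fun {a a'} ha ha' b hb => by rw [map_mul, mul_assoc]; exact ha _ (ha' _ hb)
      add_mem' := fun {a a'} ha ha' b hb => by
        rw [map_add, add_mul]; exact N.add_mem (ha _ hb) (ha' _ hb)
      algebraMap_mem' := fun r b hb => by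
        rw [AlgHom.commutes, ← Algebra.smul_def]; exact N.smul_mem r hb }
  have key : ∀ (e p : Fin n → ℤ) (c : Laurent k n) (b : Torus q),
      (SkewMonoidAlgebra.single (deg q e) c * b : Torus q).coeff (deg q p) =
        c * twist q e (b.coeff (deg q (p - e))) := by
    intro e p c b
    rw [SkewMonoidAlgebra.coeff_single_mul, deg_smul, ← deg_neg, ← deg_add, sub_eq_neg_add]
  have shift : ∀ (e p : Fin n → ℤ) (b : Torus q), b ∈ N → p j - e j < 0 →
      binom n d j ((q j ^ ((1 + p j) * d) : kˣ) : k) ∣ twist q e (b.coeff (deg q (p - e))) := by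
    intro e p b hb h
    have := map_dvd (twist q e) (hb (p - e) h)
    rw [twist_binom, ← Units.val_mul, ← zpow_add] at this
    convert this using 5
    simp; ring
  have hL : ∀ c, ofLaurent d q c ∈ S := fun c b hb p hp => by
    rw [toTorus_ofLaurent, coeffHom_apply, ← deg_zero, key]
    exact (shift 0 p b hb (by simpa using hp)).mul_left _
  have hS : S = ⊤ := by
    refine subalgebra_eq_top S (fun i b hb p hp => ?_) (fun i b hb p hp => ?_) (fun i => ?_)
      (fun i => ?_)
    · rw [toTorus_X, key]
      refine (shift _ p b hb ?_).mul_left _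
      rcases eq_or_ne i j with rfl | hij
      · simp; omega
      · simpa [hij.symm] using hp
    · rw [toTorus_Y, key]
      by_cases h : p j - (-Pi.single i 1 : Fin n → ℤ) j < 0
      · exact (shift _ p b hb h).mul_left _
      · rcases eq_or_ne i j with rfl | hij
        -- The degree passes from nonnegative to negative only at `p_i = -1`, and there the
        -- coefficient `h_i^d - 1` of `y_i` is itself the required divisor.
        · have h0 : 1 + p i = 0 := by simp at h; omega
          rw [h0, zero_mul, zpow_zero, Units.val_one]
          exact dvd_mul_right _ _
        · simp [hij.symm] at h; omega
    · rw [← ofLaurent_single_one]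
      exact hL _
    · rw [← hPow_single, ← hPow_neg, ← one_smul k (Units.val _), ← ofLaurent_single]
      exact hL _
  have h1 : (1 : Torus q) ∈ N := fun p hp => by
    rw [SkewMonoidAlgebra.coeff_one, ← deg_zero, Finsupp.single_eq_of_ne]
    · exact dvd_zero _
    · intro h
      rw [(deg q).injective h] at hp
      simp at hp
  have := (hS.ge trivial : a ∈ S) 1 h1 p hp
  rwa [mul_one] at this

end divisibility

/-! ### Divisibility between binomials -/

section roots

/-- Substituting `ρ` for `h_j` in a Laurent polynomial. -/
def substitute {K : Type*} [Field K] [Algebra k K] (j : Fin n) (ρ : Kˣ) :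
    Laurent k n →ₐ[k] AddMonoidAlgebra K (Fin n → ℤ) :=
  AddMonoidAlgebra.lift k (AddMonoidAlgebra K (Fin n → ℤ)) (Fin n → ℤ)
    { toFun := fun m =>
        AddMonoidAlgebra.single (m.toAdd - Pi.single j (m.toAdd j)) ((ρ ^ (m.toAdd j) : Kˣ) : K)
      map_one' := by simp [AddMonoidAlgebra.one_def]
      map_mul' := fun a b => by
        simp [AddMonoidAlgebra.single_mul_single, zpow_add, Pi.single_add, add_sub_add_comm] }

theorem substitute_single {K : Type*} [Field K] [Algebra k K] (j : Fin n) (ρ : Kˣ)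
    (m : Fin n → ℤ) (a : k) :
    substitute (k := k) j ρ (AddMonoidAlgebra.single m a) =
      AddMonoidAlgebra.single (m - Pi.single j (m j))
        (algebraMap k K a * ((ρ ^ (m j) : Kˣ) : K)) := by
  simp [substitute, AddMonoidAlgebra.lift_single, Algebra.smul_def]

/-- There is a field extension in which `c h_j^d - 1` can be made to vanish. -/
theorem exists_root_binom {d : ℕ} (hd : 0 < d) (j : Fin n) (c : kˣ) :
    ∃ ρ : (AlgebraicClosure k)ˣ,
      ρ ^ d = Units.map (algebraMap k (AlgebraicClosure k) : k →* AlgebraicClosure k) c⁻¹ ∧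
      substitute j ρ (binom n d j (c : k)) = 0 := by
  obtain ⟨z, hz⟩ := IsAlgClosed.exists_pow_nat_eq
    (algebraMap k (AlgebraicClosure k) ((c⁻¹ : kˣ) : k)) hd
  have hz0 : z ≠ 0 := by
    rintro rfl
    rw [zero_pow hd.ne'] at hz
    exact (c⁻¹).ne_zero ((map_eq_zero _).1 hz.symm)
  have h1 : (Units.mk0 z hz0) ^ d =
      Units.map (algebraMap k (AlgebraicClosure k) : k →* AlgebraicClosure k) c⁻¹ :=
    Units.ext (by simpa using hz)
  refine ⟨Units.mk0 z hz0, h1, ?_⟩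
  rw [binom, map_sub, map_one, substitute_single, sub_eq_zero, Pi.single_eq_same, zpow_natCast, h1,
    sub_self, AddMonoidAlgebra.one_def]
  simp

/-- A homomorphism to a nontrivial ring kills it. -/
theorem not_isUnit_binom {d : ℕ} (hd : 0 < d) (j : Fin n) (c : kˣ) :
    ¬ IsUnit (binom n d j (c : k)) := by
  obtain ⟨ρ, -, h⟩ := exists_root_binom hd j c
  intro hu
  have := hu.map (substitute j ρ)
  rw [h] at this
  exact not_isUnit_zero this

/-- Put `h_j = ρ` with `ρ^d = c⁻¹`. The divisor vanishes, so `γ c^{-m_j}` times the part of `h^{dm}`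
without `h_j` equals 1; compare exponents and coefficients. -/
theorem eq_of_binom_dvd {d : ℕ} (hd : 0 < d) {j : Fin n} {c γ : kˣ} {m : Fin n → ℤ}
    (h : binom n d j (c : k) ∣ AddMonoidAlgebra.single ((d : ℤ) • m) (γ : k) - 1) :
    (∀ l, l ≠ j → m l = 0) ∧ γ = c ^ m j := by
  obtain ⟨ρ, h1, h2⟩ := exists_root_binom hd j c
  have h3 := map_dvd (substitute j ρ) h
  rw [h2, zero_dvd_iff, map_sub, map_one, sub_eq_zero, substitute_single,
    AddMonoidAlgebra.one_def, AddMonoidAlgebra.single_inj] at h3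
  obtain ⟨h4, h5⟩ := h3.resolve_right fun h => one_ne_zero h.2
  constructor
  · intro l hl
    have := congrFun h4 l
    simpa [hl, hd.ne'] using this
  · have h6 : Units.map (algebraMap k (AlgebraicClosure k) : k →* AlgebraicClosure k) γ =
        Units.map (algebraMap k (AlgebraicClosure k) : k →* AlgebraicClosure k) (c ^ m j) := by
      rw [Pi.smul_apply, smul_eq_mul, zpow_mul, zpow_natCast, h1, ← map_zpow, inv_zpow, map_inv]
        at h5
      rw [← mul_inv_eq_one]
      exact Units.ext h5
    exact Units.map_injective (algebraMap k (AlgebraicClosure k)).injective h6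

theorem isUnit_of_twist {q : Fin n → kˣ} {p : Fin n → ℤ} {c : Laurent k n}
    (h : IsUnit (twist q p c)) : IsUnit c := by
  have := h.map (twist q (-p))
  rwa [← AlgHom.comp_apply, ← twist_add, neg_add_cancel, twist_zero] at this

/-- If `h_j^d - 1` divides one of two factors of `γ h_j^{±d} - 1`, then `γ = 1` and the other one
is a unit. -/
theorem isUnit_of_binom_dvd {d : ℕ} (hd : 0 < d) {j : Fin n} {γ : kˣ} {c : ℤ}
    (hc : c = 1 ∨ c = -1) {f g : Laurent k n} (hf : binom n d j 1 ∣ f)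
    (h : f * g = AddMonoidAlgebra.single ((d : ℤ) • Pi.single j c) (γ : k) - 1) :
    γ = 1 ∧ IsUnit g := by
  have hγ : γ = 1 := by
    have := eq_of_binom_dvd hd (j := j) (c := 1) (γ := γ) (m := Pi.single j c) (by rw [Units.val_one, ← h]; exact hf.mul_right g)
    simpa using this.2
  refine ⟨hγ, ?_⟩
  subst hγ
  obtain ⟨f', rfl⟩ := hf
  -- Both binomials are associates of `h_j^d - 1`, since `h_j^{-d} - 1 = -h_j^{-d}(h_j^d - 1)`.
  have h0 : ∃ v : (Laurent k n)ˣ,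
      (AddMonoidAlgebra.single ((d : ℤ) • Pi.single j c) 1 - 1 : Laurent k n) =
        binom n d j (1 : k) * (v : Laurent k n) := by
    rcases hc with rfl | rfl
    · refine ⟨1, ?_⟩
      rw [binom, ← Pi.single_smul]
      simp
    · refine ⟨-monomial k (Pi.single j (-(d : ℤ))), ?_⟩
      rw [binom, ← Pi.single_smul, Units.val_neg, monomial, mul_neg, sub_mul,
        AddMonoidAlgebra.single_mul_single, ← Pi.single_add]
      simp [AddMonoidAlgebra.one_def]
  obtain ⟨v, hv⟩ := h0
  rw [Units.val_one, hv, mul_assoc] at h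
  have := mul_left_cancel₀ (binom_ne_zero hd j 1) h
  exact isUnit_of_mul_isUnit_right (this ▸ v.isUnit)

end roots

/-! ### Units of the algebra -/

section units

variable {d : ℕ} {q : Fin n → kˣ}

/-- The unit `α h^m`. -/
def unitMonomial (d : ℕ) (q : Fin n → kˣ) (α : kˣ) (m : Fin n → ℤ) : (QWAlg d q)ˣ :=
  Units.map (algebraMap k (QWAlg d q) : k →* QWAlg d q) α * hPow d q m

theorem coe_unitMonomial (α : kˣ) (m : Fin n → ℤ) :
    (unitMonomial d q α m : QWAlg d q) = ofLaurent d q (AddMonoidAlgebra.single m (α : k)) := by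
  rw [ofLaurent_single, Algebra.smul_def]; rfl

theorem unitMonomial_injective {α β : kˣ} {m m' : Fin n → ℤ}
    (h : unitMonomial d q α m = unitMonomial d q β m') : α = β ∧ m = m' := by
  have := congrArg (Units.val) h
  rw [coe_unitMonomial, coe_unitMonomial] at this
  have := AddMonoidAlgebra.single_inj.1 (ofLaurent_injective this)
  obtain ⟨h1, h2⟩ := this.resolve_right fun h => α.ne_zero h.1
  exact ⟨Units.ext h2, h1⟩

theorem unitMonomial_mul (α β : kˣ) (m m' : Fin n → ℤ) :
    unitMonomial d q α m * unitMonomial d q β m' = unitMonomial d q (α * β) (m + m') := by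
  refine Units.ext ?_
  rw [Units.val_mul, coe_unitMonomial, coe_unitMonomial, coe_unitMonomial, ← map_mul,
    AddMonoidAlgebra.single_mul_single, Units.val_mul]

theorem unitMonomial_zpow (α : kˣ) (m : Fin n → ℤ) (c : ℤ) :
    unitMonomial d q α m ^ c = unitMonomial d q (α ^ c) (c • m) := by
  rw [unitMonomial, Commute.mul_zpow, unitMonomial, ← map_zpow, hPow_smul]
  exact Units.ext (Algebra.commutes _ _)

theorem H_eq_unitMonomial (i : Fin n) : H d q i = unitMonomial d q 1 (Pi.single i 1) := by
  rw [unitMonomial, map_one, one_mul, hPow_single]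

/-- Units of the torus are homogeneous with a monomial coefficient. A negative `p_j` would make this
invertible coefficient divisible by a nonunit binomial. -/
theorem exists_toTorus_unit (hd : 0 < d) (u : (QWAlg d q)ˣ) :
    ∃ p α m, 0 ≤ p ∧ toTorus d q u =
      SkewMonoidAlgebra.single (deg q p) (AddMonoidAlgebra.single m ((α : kˣ) : k)) := by
  have h : toTorus d q u * toTorus d q (u⁻¹ : (QWAlg d q)ˣ) = SkewMonoidAlgebra.single 1 1 := by
    rw [← map_mul, Units.mul_inv, map_one]; rfl
  obtain ⟨p, a, p', b, hp, -, -, hab⟩ :=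
    SkewMonoidAlgebra.exists_eq_single_of_mul_eq_single one_ne_zero h
  obtain ⟨m, α, hα, rfl⟩ := AddMonoidAlgebra.exists_eq_single_of_mul_eq_one hab
  refine ⟨(deg q).symm p, Units.mk0 α hα, m, fun j => ?_, by simpa using hp⟩
  by_contra! hj
  have := binom_dvd_coeff j (u : QWAlg d q) _ hj
  rw [hp, Equiv.apply_symm_apply, SkewMonoidAlgebra.coeff_single, Finsupp.single_eq_same] at this
  exact not_isUnit_binom hd j _ (isUnit_of_dvd_unit this (IsUnit.of_mul_eq_one _ hab))

/-- The units of `A(n,d,q)` are the scaled monomials in the `h_i`. -/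
theorem exists_eq_unitMonomial (hd : 0 < d) (u : (QWAlg d q)ˣ) :
    ∃ α m, u = unitMonomial d q α m := by
  obtain ⟨p, α, m, hp, h⟩ := exists_toTorus_unit hd u
  obtain ⟨p', β, m', hp', h'⟩ := exists_toTorus_unit hd u⁻¹
  have e : toTorus d q u * toTorus d q (u⁻¹ : (QWAlg d q)ˣ) = 1 := by
    rw [← map_mul, Units.mul_inv, map_one]
  rw [h, h', coe_single_mul, SkewMonoidAlgebra.one_def] at e
  have hc := congrArg (fun z => SkewMonoidAlgebra.coeff z (1 : Deg q)) e
  -- The degrees of `u` and `u⁻¹` are both nonnegative and add up to zero, so both vanish.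
  have hpp : p + p' = 0 := by
    by_contra hne
    have h2 : (1 : Deg q) ≠ deg q (p + p') := fun h => hne ((deg q).injective h).symm
    simp only [SkewMonoidAlgebra.coeff_single, Finsupp.single_eq_same,
      Finsupp.single_eq_of_ne h2] at hc
    exact zero_ne_one hc
  have hp0 : p = 0 := by
    ext j
    have h1 := hp j
    have h2 := hp' j
    have h3 := congrFun hpp j
    simp at *
    omega
  refine ⟨α, m, Units.ext (toTorus_injective hd ?_)⟩
  rw [h, coe_unitMonomial, toTorus_ofLaurent, hp0]; rfl

end units

/-! ### Images of the generators under an automorphism -/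

section automorphisms

variable {d : ℕ} {q : Fin n → kˣ}

theorem smul_unitMonomial_pow (r α : kˣ) (m : Fin n → ℤ) (s : ℕ) :
    ((r : k) • (unitMonomial d q α m : QWAlg d q)) ^ s =
      ofLaurent d q (AddMonoidAlgebra.single ((s : ℤ) • m) (((r * α) ^ s : kˣ) : k)) := by
  rw [coe_unitMonomial, ← map_smul, ← map_pow, AddMonoidAlgebra.smul_single,
    AddMonoidAlgebra.single_pow]
  simp

/-- The images of `x_i` and `y_i` under an automorphism are homogeneous of opposite degrees. -/
theorem exists_toTorus_map (hd : 0 < d) (ψ : QWAlg d q ≃ₐ[k] QWAlg d q) (i : Fin n) :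
    ∃ α m p a b, Units.map (ψ : QWAlg d q →* QWAlg d q) (H d q i) = unitMonomial d q α m ∧
      toTorus d q (ψ (X d q i)) = SkewMonoidAlgebra.single (deg q p) a ∧
      toTorus d q (ψ (Y d q i)) = SkewMonoidAlgebra.single (deg q (-p)) b ∧
      a * twist q p b =
        AddMonoidAlgebra.single ((d : ℤ) • m) (((q i * α) ^ d : kˣ) : k) - 1 ∧
      b * twist q (-p) a = AddMonoidAlgebra.single ((d : ℤ) • m) ((α ^ d : kˣ) : k) - 1 ∧
      pairing q p m = q i := by
  obtain ⟨α, m, hH⟩ := exists_eq_unitMonomial hd (Units.map (ψ : QWAlg d q →* QWAlg d q) (H d q i))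
  have hH' : ψ (H d q i : QWAlg d q) = unitMonomial d q α m := congrArg Units.val hH
  have hxy : ψ (X d q i) * ψ (Y d q i) = ofLaurent d q
      (AddMonoidAlgebra.single ((d : ℤ) • m) (((q i * α) ^ d : kˣ) : k) - 1) := by
    rw [← map_mul, X_mul_Y, map_sub, map_pow, map_smul, map_one, hH', smul_unitMonomial_pow,
      map_sub, map_one]
  have hyx : ψ (Y d q i) * ψ (X d q i) = ofLaurent d q
      (AddMonoidAlgebra.single ((d : ℤ) • m) ((α ^ d : kˣ) : k) - 1) := by
    have := smul_unitMonomial_pow (d := d) (q := q) 1 α m d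
    rw [Units.val_one, one_smul, one_mul] at this
    rw [← map_mul, Y_mul_X, map_sub, map_pow, map_one, hH', this, map_sub, map_one]
  -- Since `m = 0` is not yet excluded, the nonvanishing is drawn from `x_i y_i ≠ 0` and the
  -- injectivity of ψ.
  have hc : (AddMonoidAlgebra.single ((d : ℤ) • m) (((q i * α) ^ d : kˣ) : k) - 1 : Laurent k n)
      ≠ 0 := by
    intro h0
    rw [h0, map_zero, ← map_mul, map_eq_zero_iff ψ ψ.injective] at hxy
    obtain ⟨c, hc, h⟩ := (isHomog_X (d := d) (q := q) i).mul (isHomog_Y hd i)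
    rw [← map_mul, hxy, map_zero] at h
    exact hc (SkewMonoidAlgebra.single_eq_zero.1 h.symm)
  have hxy' := congrArg (toTorus d q) hxy
  rw [map_mul, toTorus_ofLaurent, coeffHom_apply] at hxy'
  obtain ⟨p, a, p', b, hX, hY, hp, hab⟩ :=
    SkewMonoidAlgebra.exists_eq_single_of_mul_eq_single hc hxy'
  obtain ⟨p, rfl⟩ := (deg q).surjective p
  obtain rfl : p' = deg q (-p) := by rw [deg_neg]; exact eq_inv_of_mul_eq_one_right hp
  rw [deg_smul] at hab
  refine ⟨α, m, p, a, b, hH, hX, hY, hab, ?_, ?_⟩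
  · have := congrArg (toTorus d q) hyx
    rw [map_mul, hX, hY, coe_single_mul, toTorus_ofLaurent, neg_add_cancel] at this
    exact SkewMonoidAlgebra.single_injective _ this
  -- In the image of `x_i h_i = q_i h_i x_i` the nonzero coefficient `a` cancels, leaving the
  -- character by which degree `p` acts on `h^m`.
  · have := congrArg (fun z => toTorus d q (ψ z)) (X_mul_H (d := d) (q := q) i)
    simp only [map_mul, map_smul, hX, hH', coe_unitMonomial, toTorus_ofLaurent,
      single_mul_coeffHom, coeffHom_mul_single, smul_single_deg, twist_single] at this
    have := SkewMonoidAlgebra.single_injective _ this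
    have ha : a ≠ 0 := by
      rintro rfl
      rw [zero_mul] at hab
      exact hc hab.symm
    rw [mul_comm a, ← smul_mul_assoc] at this
    have := mul_right_cancel₀ ha this
    rw [AddMonoidAlgebra.smul_single, AddMonoidAlgebra.single_right_inj, smul_eq_mul,
      mul_comm] at this
    exact Units.ext (mul_right_cancel₀ α.ne_zero this)

/-- The images of `x_i`, `y_i` and `h_i` under an automorphism involve a single index. -/
theorem exists_index (hd : 0 < d) (hq : ∀ i, q i ≠ 1) (ψ : QWAlg d q ≃ₐ[k] QWAlg d q)
    (i : Fin n) : ∃ α j c s a b,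
      Units.map (ψ : QWAlg d q →* QWAlg d q) (H d q i) = unitMonomial d q α (Pi.single j c) ∧
      toTorus d q (ψ (X d q i)) = SkewMonoidAlgebra.single (deg q (Pi.single j s)) a ∧
      toTorus d q (ψ (Y d q i)) = SkewMonoidAlgebra.single (deg q (-Pi.single j s)) b ∧
      a * twist q (Pi.single j s) b = AddMonoidAlgebra.single ((d : ℤ) • Pi.single j c)
        (((q i * α) ^ d : kˣ) : k) - 1 ∧
      b * twist q (-Pi.single j s) a = AddMonoidAlgebra.single ((d : ℤ) • Pi.single j c)
        ((α ^ d : kˣ) : k) - 1 ∧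
      q j ^ (s * c) = q i := by
  obtain ⟨α, m, p, a, b, hH, hX, hY, hab, hba, hpm⟩ := exists_toTorus_map hd ψ i
  have hm0 : m ≠ 0 := by
    rintro rfl
    rw [pairing_zero_right] at hpm
    exact hq i hpm.symm
  have hp0 : p ≠ 0 := by
    rintro rfl
    rw [pairing_zero_left] at hpm
    exact hq i hpm.symm
  -- Whichever of `ψ(x_i)`, `ψ(y_i)` has negative degree at `j` has a coefficient divisible by a
  -- binomial in `h_j`, and this coefficient divides a binomial in `h^{dm}`.
  have key : ∀ j, p j ≠ 0 → ∀ l, l ≠ j → m l = 0 := by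
    intro j hj
    rcases lt_or_gt_of_ne hj with h | h
    · have := binom_dvd_coeff j (ψ (X d q i)) p h
      rw [hX, SkewMonoidAlgebra.coeff_single, Finsupp.single_eq_same] at this
      exact (eq_of_binom_dvd hd (hab ▸ this.mul_right _)).1
    · have := binom_dvd_coeff j (ψ (Y d q i)) (-p) (by simpa using h)
      rw [hY, SkewMonoidAlgebra.coeff_single, Finsupp.single_eq_same] at this
      exact (eq_of_binom_dvd hd (hba ▸ this.mul_right _)).1
  obtain ⟨j, hj⟩ := Function.ne_iff.1 hp0
  obtain ⟨c, rfl⟩ : ∃ c, m = Pi.single j c := by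
    refine ⟨m j, funext fun l => ?_⟩
    rcases eq_or_ne l j with rfl | hl
    · simp
    · simp [hl, key j hj l hl]
  obtain ⟨s, rfl⟩ : ∃ s, p = Pi.single j s := by
    refine ⟨p j, funext fun l => ?_⟩
    rcases eq_or_ne l j with rfl | hl
    · simp
    -- A second index `l` with `p_l ≠ 0` would also force `m_j = 0`, hence `m = 0`.
    · by_contra h
      refine hm0 (funext fun r => ?_)
      rcases eq_or_ne r j with rfl | hr
      · exact key l (by simpa [hl] using h) _ hl.symm
      · simp [hr]
  rw [pairing_single_left, Pi.single_eq_same] at hpm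
  exact ⟨α, j, c, s, a, b, hH, hX, hY, hab, hba, hpm⟩

/-- Applying ψ to `φ(h_i) = β h_j^e` gives a scalar times `h_l^{ce}`, which must be `h_i`. Used for
ψ and its inverse in both orders, this makes the index map bijective and the exponents ±1. -/
theorem map_H_comp {ψ φ : QWAlg d q ≃ₐ[k] QWAlg d q} (hψφ : ∀ a, ψ (φ a) = a) {i j l : Fin n}
    {α β : kˣ} {c e : ℤ}
    (h : Units.map (φ : QWAlg d q →* QWAlg d q) (H d q i) = unitMonomial d q β (Pi.single j e))
    (h' : Units.map (ψ : QWAlg d q →* QWAlg d q) (H d q j) = unitMonomial d q α (Pi.single l c)) :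
    l = i ∧ c * e = 1 := by
  have h1 : Units.map (ψ : QWAlg d q →* QWAlg d q) (unitMonomial d q β (Pi.single j e)) =
      H d q i := by
    rw [← h]
    exact Units.ext (hψφ _)
  have h2 : unitMonomial d q β (Pi.single j e) =
      Units.map (algebraMap k (QWAlg d q) : k →* QWAlg d q) β * H d q j ^ e := by
    rw [unitMonomial, ← hPow_single, ← hPow_smul, ← Pi.single_smul]
    simp
  have h3 : Units.map (ψ : QWAlg d q →* QWAlg d q)
      (Units.map (algebraMap k (QWAlg d q) : k →* QWAlg d q) β) = unitMonomial d q β 0 := by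
    rw [unitMonomial, hPow_zero, mul_one]
    exact Units.ext (ψ.commutes _)
  rw [h2, map_mul, map_zpow, h', h3, unitMonomial_zpow, unitMonomial_mul, zero_add,
    H_eq_unitMonomial, ← Pi.single_smul] at h1
  have h4 := (unitMonomial_injective h1).2
  have h5 := congrFun h4 i
  rcases eq_or_ne l i with rfl | hl
  · refine ⟨rfl, ?_⟩
    rw [Pi.single_eq_same, Pi.single_eq_same, smul_eq_mul, mul_comm] at h5
    exact h5
  · rw [Pi.single_eq_of_ne hl.symm, Pi.single_eq_same] at h5
    exact absurd h5 zero_ne_one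

end automorphisms

/-! ### Automorphisms up to units of the Laurent polynomials -/

section classification

variable {d : ℕ} {q : kˣ}

/-- Up to units of the Laurent polynomial ring, an automorphism permutes the tensor factors,
composed in each of them with `h ↦ α h^{±1}` and possibly an exchange of `x` and `y`. -/
theorem exists_perm (hd : 0 < d) (hq : q ≠ 1) (ψ : Aut n d q) :
    ∃ w : Equiv.Perm (Fin n), ∀ i, ∃ α c, (c = 1 ∨ c = -1) ∧
      ψ (H d (fun _ => q) i) = unitMonomial d (fun _ => q) α (Pi.single (w i) c) ∧
      ((α ^ d = 1 ∧ q ^ c = q ∧ ∃ u : (Laurent k n)ˣ,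
          ψ (X d (fun _ => q) i) = ofLaurent d (fun _ => q) u * X d (fun _ => q) (w i)) ∨
        ((q * α) ^ d = 1 ∧ q ^ (-c) = q ∧ ∃ u : (Laurent k n)ˣ,
          ψ (Y d (fun _ => q) i) = ofLaurent d (fun _ => q) u * X d (fun _ => q) (w i))) := by
  choose α w c s a b hH hX hY hab hba hsc using exists_index (q := fun _ : Fin n => q) hd
    (fun _ => hq) ψ
  choose α' w' c' s' a' b' hH' hX' hY' hab' hba' hsc' using
    exists_index (q := fun _ : Fin n => q) hd (fun _ => hq) ψ.symm
  have h1 := fun i => map_H_comp (ψ := ψ) (φ := ψ.symm) (fun a => by simp) (hH' i) (hH (w' i))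
  have h2 := fun i => map_H_comp (ψ := ψ.symm) (φ := ψ) (fun a => by simp) (hH i) (hH' (w i))
  let W : Equiv.Perm (Fin n) := ⟨w, w', fun i => (h2 i).1, fun i => (h1 i).1⟩
  refine ⟨W, fun i => ?_⟩
  have hc : c i = 1 ∨ c i = -1 := Int.isUnit_iff.1 (IsUnit.of_mul_eq_one_right _ (h2 i).2)
  -- Every degree occurring in the image of ψ has its `w(i)`-th coordinate divisible by `s_i`, as
  -- this holds on generators. Since ψ is onto, `x_{w(i)}` is in the image, so `s_i` divides 1.
  have hs : s i = 1 ∨ s i = -1 := by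
    let T : Submonoid (Deg fun _ : Fin n => q) :=
      { carrier := {p | s i ∣ (deg _).symm p (w i)}
        one_mem' := dvd_zero _
        mul_mem' := fun ha hb => dvd_add ha hb }
    let S := (SkewMonoidAlgebra.supportedIn k (R := Laurent k n) T).comap
      ((toTorus d fun _ : Fin n => q).comp ψ.toAlgHom)
    have hmem : ∀ l, s i ∣ (Pi.single (w l) (s l) : Fin n → ℤ) (w i) := by
      intro l
      rcases eq_or_ne l i with rfl | hl
      · simp
      · have hw : w i ≠ w l := fun h => hl (W.injective h).symm
        rw [Pi.single_eq_of_ne hw]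
        exact dvd_zero _
    have hmemS : ∀ z, z ∈ S ↔ toTorus d _ (ψ z) ∈
        SkewMonoidAlgebra.supportedIn k (R := Laurent k n) T := fun z => Iff.rfl
    have hunit : ∀ v : (QWAlg d fun _ : Fin n => q)ˣ, (v : QWAlg d fun _ : Fin n => q) ∈ S := by
      intro v
      obtain ⟨β, m, hv⟩ := exists_eq_unitMonomial hd
        (Units.map (ψ : (QWAlg d fun _ : Fin n => q) →* QWAlg d fun _ : Fin n => q) v)
      have hv' : ψ v = _ := congrArg Units.val hv
      rw [hmemS, hv', coe_unitMonomial, toTorus_ofLaurent]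
      exact SkewMonoidAlgebra.single_mem_supportedIn T.one_mem _
    have hS : S = ⊤ := by
      refine subalgebra_eq_top S (fun l => ?_) (fun l => ?_) (fun l => hunit _) (fun l => hunit _)
      · rw [hmemS, hX]
        exact SkewMonoidAlgebra.single_mem_supportedIn (hmem l) _
      · rw [hmemS, hY]
        exact SkewMonoidAlgebra.single_mem_supportedIn ((hmem l).neg_right) _
    have h3 : ψ.symm (X d _ (w i)) ∈ S := hS.ge trivial
    rw [hmemS, AlgEquiv.apply_symm_apply, toTorus_X] at h3
    have h4 : s i ∣ (Pi.single (w i) 1 : Fin n → ℤ) (w i) :=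
      SkewMonoidAlgebra.mem_of_single_mem_supportedIn one_ne_zero h3
    rw [Pi.single_eq_same] at h4
    exact Int.isUnit_iff.1 (isUnit_of_dvd_one h4)
  -- In degree -1 the power of `q` in the divisor is trivial.
  have hdvd : ∀ z : QWAlg d fun _ : Fin n => q, binom n d (w i) (1 : k) ∣
      (toTorus d _ z).coeff (deg _ (-Pi.single (w i) 1)) := fun z => by
    simpa using binom_dvd_coeff (w i) z (-Pi.single (w i) 1) (by simp)
  have lin : ∀ {z : QWAlg d fun _ : Fin n => q} {f : Laurent k n},
      toTorus d _ z = SkewMonoidAlgebra.single (deg _ (Pi.single (w i) 1)) f →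
      z = ofLaurent d _ f * X d _ (w i) := fun {z f} hz => toTorus_injective hd (by
    rw [hz, map_mul, toTorus_ofLaurent, toTorus_X, coeffHom_mul_single, mul_one])
  refine ⟨α i, c i, hc, congrArg Units.val (hH i), ?_⟩
  specialize hX i; specialize hY i; specialize hab i; specialize hba i; specialize hsc i
  -- Of `ψ(x_i)` and `ψ(y_i)`, the one of degree -1 carries the whole factor `h_{w(i)}^d - 1` of the
  -- binomial, so the coefficient of the one of degree 1 is a unit.
  rcases hs with hs | hs
  · left
    rw [hs] at hX hY hab hba hsc
    have h5 := hdvd (ψ (Y d _ i))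
    rw [hY, SkewMonoidAlgebra.coeff_single, Finsupp.single_eq_same] at h5
    obtain ⟨hα, hu⟩ := isUnit_of_binom_dvd hd hc h5 hba
    obtain ⟨u, hu⟩ := isUnit_of_twist hu
    exact ⟨hα, by simpa using hsc, u, by rw [hu]; exact lin hX⟩
  · right
    rw [hs] at hX hY hab hba hsc
    rw [Pi.single_neg] at hX hY hab hba
    rw [neg_neg] at hY
    have h5 := hdvd (ψ (X d _ i))
    rw [hX, SkewMonoidAlgebra.coeff_single, Finsupp.single_eq_same] at h5
    obtain ⟨hα, hu⟩ := isUnit_of_binom_dvd hd hc h5 hab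
    obtain ⟨u, hu⟩ := isUnit_of_twist hu
    exact ⟨hα, by simpa using hsc, u, by rw [hu]; exact lin hY⟩

end classification

/-! ### Calculus of the units `α h_i^c` -/

section hMonomial

variable {d : ℕ} {q : Fin n → kˣ}

/-- The unit `α h_i^c`. -/
def hMon (d : ℕ) (q : Fin n → kˣ) (i : Fin n) (α : kˣ) (c : ℤ) : (QWAlg d q)ˣ :=
  unitMonomial d q α (Pi.single i c)

theorem H_eq_hMon (i : Fin n) : H d q i = hMon d q i 1 1 := H_eq_unitMonomial i

theorem hMon_one_zero (i : Fin n) : hMon d q i 1 0 = 1 := by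
  rw [hMon, unitMonomial, map_one, one_mul, Pi.single_zero, hPow_zero]

theorem hMon_mul (i : Fin n) (α β : kˣ) (c e : ℤ) :
    hMon d q i α c * hMon d q i β e = hMon d q i (α * β) (c + e) := by
  rw [hMon, hMon, unitMonomial_mul, hMon, Pi.single_add]

theorem coe_hMon_mul (i : Fin n) (α β : kˣ) (c e : ℤ) :
    (hMon d q i α c * hMon d q i β e : QWAlg d q) = hMon d q i (α * β) (c + e) := by
  rw [← Units.val_mul, hMon_mul]

theorem hMon_zpow (i : Fin n) (α : kˣ) (c e : ℤ) :
    hMon d q i α c ^ e = hMon d q i (α ^ e) (c * e) := by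
  rw [hMon, unitMonomial_zpow, hMon, ← Pi.single_smul, smul_eq_mul, mul_comm]

theorem coe_hMon_pow (i : Fin n) (α : kˣ) (c : ℤ) (s : ℕ) :
    (hMon d q i α c : QWAlg d q) ^ s = hMon d q i (α ^ s) (c * s) := by
  rw [← Units.val_pow_eq_pow_val, ← zpow_natCast, hMon_zpow, zpow_natCast]

theorem smul_hMon (i : Fin n) (r α : kˣ) (c : ℤ) :
    (r : k) • (hMon d q i α c : QWAlg d q) = hMon d q i (r * α) c := by
  rw [hMon, hMon, coe_unitMonomial, coe_unitMonomial, ← map_smul, AddMonoidAlgebra.smul_single,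
    smul_eq_mul, Units.val_mul]

theorem neg_hMon (i : Fin n) (α : kˣ) (c : ℤ) :
    (hMon d q i (-α) c : QWAlg d q) = -hMon d q i α c := by
  rw [hMon, hMon, coe_unitMonomial, coe_unitMonomial, Units.val_neg,
    AddMonoidAlgebra.single_neg, map_neg]

theorem X_mul_hMon (i : Fin n) (α : kˣ) (c : ℤ) :
    X d q i * hMon d q i α c = hMon d q i (α * q i ^ c) c * X d q i := by
  rw [hMon, coe_unitMonomial, X_mul_ofLaurent, twist_single, pairing_single_left,
    Pi.single_eq_same, one_mul, hMon, coe_unitMonomial, Units.val_mul]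

theorem Y_mul_hMon (i : Fin n) (α : kˣ) (c : ℤ) :
    Y d q i * hMon d q i α c = hMon d q i (α * q i ^ (-c)) c * Y d q i := by
  rw [hMon, coe_unitMonomial, Y_mul_ofLaurent, twist_single, ← Pi.single_neg,
    pairing_single_left, Pi.single_eq_same, neg_one_mul, hMon, coe_unitMonomial, Units.val_mul]

theorem X_mul_Y_eq_hMon (i : Fin n) :
    X d q i * Y d q i = (hMon d q i (q i ^ d) d : QWAlg d q) - 1 := by
  rw [X_mul_Y, H_eq_hMon, smul_hMon, coe_hMon_pow, mul_one, one_mul]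

theorem Y_mul_X_eq_hMon (i : Fin n) :
    Y d q i * X d q i = (hMon d q i 1 d : QWAlg d q) - 1 := by
  rw [Y_mul_X, H_eq_hMon, coe_hMon_pow, one_pow, one_mul]

theorem map_hMon {N : ℕ} {q' : Fin N → kˣ} {F : QWAlg d q →ₐ[k] QWAlg d q'} {i : Fin n}
    {j : Fin N} {β : kˣ} {e : ℤ} (h : F (H d q i : QWAlg d q) = hMon d q' j β e) (α : kˣ) (c : ℤ) :
    F (hMon d q i α c : QWAlg d q) = hMon d q' j (α * β ^ c) (e * c) := by
  have h1 : Units.map (F : QWAlg d q →* QWAlg d q') (H d q i) = hMon d q' j β e := Units.ext h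
  have h2 : (hMon d q i α c : QWAlg d q) = (α : k) • ((H d q i ^ c : (QWAlg d q)ˣ) : QWAlg d q) := by
    rw [H_eq_hMon, hMon_zpow, smul_hMon, one_zpow, mul_one, one_mul]
  have h3 : F ((H d q i ^ c : (QWAlg d q)ˣ) : QWAlg d q) = hMon d q' j (β ^ c) (e * c) := by
    have := congrArg (fun v : (QWAlg d q')ˣ => ((v ^ c : (QWAlg d q')ˣ) : QWAlg d q')) h1
    simp only [← map_zpow, hMon_zpow] at this
    exact this
  rw [h2, map_smul, h3, smul_hMon]

end hMonomial

/-! ### Permutations of the tensor factors -/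

section permutations

variable {d : ℕ} {q : kˣ}

/-- The homomorphism permuting the tensor factors. -/
def permHom (d : ℕ) (q : kˣ) (w : Equiv.Perm (Fin n)) :
    QWAlg d (fun _ : Fin n => q) →ₐ[k] QWAlg d (fun _ : Fin n => q) :=
  Realization.lift
    { x := fun i => X d _ (w i)
      y := fun i => Y d _ (w i)
      h := fun i => H d _ (w i)
      x_h := fun i => X_mul_H (w i)
      y_h := fun i => Y_mul_H (w i)
      x_y := fun i => X_mul_Y (w i)
      y_x := fun i => Y_mul_X (w i)
      h_h := fun i j _ => congrArg Units.val (H_commute d _ (w i) (w j)).eq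
      h_x := fun _ _ hij => H_commute_X (w.injective.ne hij)
      h_y := fun _ _ hij => H_commute_Y (w.injective.ne hij)
      x_x := fun _ _ _ => X_commute_X _ _
      x_y_comm := fun _ _ hij => X_commute_Y (w.injective.ne hij)
      y_y := fun _ _ _ => Y_commute_Y _ _ }

@[simp] theorem permHom_X (w : Equiv.Perm (Fin n)) (i : Fin n) :
    permHom d q w (X d _ i) = X d _ (w i) := Realization.lift_X _ i

@[simp] theorem permHom_Y (w : Equiv.Perm (Fin n)) (i : Fin n) :
    permHom d q w (Y d _ i) = Y d _ (w i) := Realization.lift_Y _ i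

@[simp] theorem permHom_H (w : Equiv.Perm (Fin n)) (i : Fin n) :
    permHom d q w (H d (fun _ => q) i : QWAlg d fun _ => q) = H d (fun _ => q) (w i) :=
  Realization.lift_H _ i

/-- The automorphism permuting the tensor factors. -/
def permAut (d : ℕ) (q : kˣ) (w : Equiv.Perm (Fin n)) : Aut n d q :=
  AlgEquiv.ofAlgHom (permHom d q w) (permHom d q w.symm)
    (algHom_ext (fun i => by simp) (fun i => by simp) (fun i => by simp))
    (algHom_ext (fun i => by simp) (fun i => by simp) (fun i => by simp))

theorem permAut_mem [NeZero n] (w : Equiv.Perm (Fin n)) : permAut d q w ∈ qwaTame n d q :=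
  Subgroup.subset_closure (Or.inl (Or.inr ⟨w, fun i =>
    ⟨permHom_H w i, permHom_X w i, permHom_Y w i⟩⟩))

end permutations

/-! ### Extending automorphisms of one tensor factor -/

section factors

variable {d : ℕ} {q : Fin n → kˣ}

theorem factor_mk (i : Fin n) (a : FreeAlgebra k (Gen 1)) :
    factor d q i (mk d _ a) = FreeAlgebra.lift k (fun g : Gen 1 => match g with
      | Gen.x _ => mk d q (fx k i)
      | Gen.y _ => mk d q (fy k i)
      | Gen.h _ => mk d q (fh k i)
      | Gen.hInv _ => mk d q (fhInv k i)) a :=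
  RingQuot.liftAlgHom_mkAlgHom_apply _ _ _ _

@[simp] theorem factor_X (i : Fin n) (j : Fin 1) : factor d q i (X d _ j) = X d q i := by
  rw [X, factor_mk, FreeAlgebra.lift_ι_apply]; rfl

@[simp] theorem factor_Y (i : Fin n) (j : Fin 1) : factor d q i (Y d _ j) = Y d q i := by
  rw [Y, factor_mk, FreeAlgebra.lift_ι_apply]; rfl

@[simp] theorem factor_H (i : Fin n) (j : Fin 1) :
    factor d q i (H d (fun _ => q i) j : QWAlg d fun _ => q i) = H d q i := by
  rw [H, factor_mk, FreeAlgebra.lift_ι_apply]; rfl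

theorem factor_hMon (i : Fin n) (j : Fin 1) (α : kˣ) (c : ℤ) :
    factor d q i (hMon d (fun _ => q i) j α c : QWAlg d fun _ => q i) = hMon d q i α c := by
  have h : factor d q i (H d (fun _ => q i) j : QWAlg d fun _ => q i) = hMon d q i 1 1 := by
    rw [factor_H, H_eq_hMon]
  rw [map_hMon h, one_zpow, mul_one, one_mul]

/-- The centralizer of `z` is a subalgebra, and it contains the inverse of any unit that it
contains. -/
theorem factor_commute {i : Fin n} {z : QWAlg d q} (hX : Commute (X d q i) z)
    (hY : Commute (Y d q i) z) (hH : Commute (H d q i : QWAlg d q) z)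
    (a : QWAlg d fun _ : Fin 1 => q i) : Commute (factor d q i a) z := by
  let S := (Subalgebra.centralizer k {z}).comap (factor d q i)
  have hmem : ∀ a, a ∈ S ↔ Commute (factor d q i a) z := fun a => by
    rw [Subalgebra.mem_comap, Subalgebra.mem_centralizer_iff]
    simp [Commute, SemiconjBy, eq_comm]
  have hS : S = ⊤ := by
    refine subalgebra_eq_top S (fun j => ?_) (fun j => ?_) (fun j => ?_) (fun j => ?_)
    · rwa [hmem, factor_X]
    · rwa [hmem, factor_Y]
    · rwa [hmem, factor_H]
    · rw [hmem]
      have h1 : Commute ((Units.map (factor d q i : (QWAlg d fun _ : Fin 1 => q i) →* QWAlg d q)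
          (H d _ j) : (QWAlg d q)ˣ) : QWAlg d q) z := by
        change Commute (factor d q i (H d (fun _ => q i) j : QWAlg d fun _ : Fin 1 => q i)) z
        rwa [factor_H]
      exact h1.units_inv_left
  rw [← hmem, hS]
  trivial

theorem factor_commute_X {i j : Fin n} (hij : i ≠ j) (a : QWAlg d fun _ : Fin 1 => q i) :
    Commute (factor d q i a) (X d q j) :=
  factor_commute (X_commute_X i j) (X_commute_Y hij.symm).symm (H_commute_X hij) a

theorem factor_commute_Y {i j : Fin n} (hij : i ≠ j) (a : QWAlg d fun _ : Fin 1 => q i) :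
    Commute (factor d q i a) (Y d q j) :=
  factor_commute (X_commute_Y hij) (Y_commute_Y i j) (H_commute_Y hij) a

theorem factor_commute_H {i j : Fin n} (hij : i ≠ j) (a : QWAlg d fun _ : Fin 1 => q i) :
    Commute (factor d q i a) (H d q j : QWAlg d q) :=
  factor_commute (H_commute_X hij.symm).symm (H_commute_Y hij.symm).symm
    (congrArg Units.val (H_commute d q i j).eq) a

/-- The realization in `A(n,d,q)` that uses `g` in the `i`-th tensor factor. -/
def factorRealization (i : Fin n)
    (g : (QWAlg d fun _ : Fin 1 => q i) →ₐ[k] QWAlg d fun _ : Fin 1 => q i) :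
    Realization d q (QWAlg d q) where
  x j := if j = i then factor d q i (g (X d _ 0)) else X d q j
  y j := if j = i then factor d q i (g (Y d _ 0)) else Y d q j
  h j := if j = i then
    Units.map ((factor d q i).comp g : (QWAlg d fun _ : Fin 1 => q i) →* QWAlg d q) (H d _ 0)
    else H d q j
  x_h j := by
    rcases eq_or_ne j i with rfl | hj
    · simp only [if_true]
      have := congrArg (fun z => factor d q j (g z))
        (X_mul_H (d := d) (q := fun _ : Fin 1 => q j) 0)
      simp only [map_mul, map_smul] at this
      exact this
    · simpa only [if_neg hj] using X_mul_H j
  y_h j := by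
    rcases eq_or_ne j i with rfl | hj
    · simp only [if_true]
      have := congrArg (fun z => factor d q j (g z))
        (Y_mul_H (d := d) (q := fun _ : Fin 1 => q j) 0)
      simp only [map_mul, map_smul] at this
      exact this
    · simpa only [if_neg hj] using Y_mul_H j
  x_y j := by
    rcases eq_or_ne j i with rfl | hj
    · simp only [if_true]
      rw [← map_mul, ← map_mul, X_mul_Y, map_sub, map_sub, map_pow, map_pow, map_smul, map_smul,
        map_one, map_one]
      rfl
    · simpa only [if_neg hj] using X_mul_Y j
  y_x j := by
    rcases eq_or_ne j i with rfl | hj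
    · simp only [if_true]
      rw [← map_mul, ← map_mul, Y_mul_X, map_sub, map_sub, map_pow, map_pow, map_one, map_one]
      rfl
    · simpa only [if_neg hj] using Y_mul_X j
  h_h j l hjl := by
    rcases eq_or_ne j i with rfl | hj
    · simp only [if_true, if_neg hjl.symm]
      exact factor_commute_H hjl _
    · rcases eq_or_ne l i with rfl | hl
      · simp only [if_true, if_neg hjl]
        exact (factor_commute_H hjl.symm _).symm
      · simp only [if_neg hj, if_neg hl]
        exact congrArg Units.val (H_commute d q j l).eq
  h_x j l hjl := by
    rcases eq_or_ne j i with rfl | hj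
    · simp only [if_true, if_neg hjl.symm]
      exact factor_commute_X hjl _
    · rcases eq_or_ne l i with rfl | hl
      · simp only [if_true, if_neg hjl]
        exact (factor_commute_H hjl.symm _).symm
      · simp only [if_neg hj, if_neg hl]
        exact H_commute_X hjl
  h_y j l hjl := by
    rcases eq_or_ne j i with rfl | hj
    · simp only [if_true, if_neg hjl.symm]
      exact factor_commute_Y hjl _
    · rcases eq_or_ne l i with rfl | hl
      · simp only [if_true, if_neg hjl]
        exact (factor_commute_H hjl.symm _).symm
      · simp only [if_neg hj, if_neg hl]
        exact H_commute_Y hjl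
  x_x j l hjl := by
    rcases eq_or_ne j i with rfl | hj
    · simp only [if_true, if_neg hjl.symm]
      exact factor_commute_X hjl _
    · rcases eq_or_ne l i with rfl | hl
      · simp only [if_true, if_neg hjl]
        exact (factor_commute_X hjl.symm _).symm
      · simp only [if_neg hj, if_neg hl]
        exact X_commute_X j l
  x_y_comm j l hjl := by
    rcases eq_or_ne j i with rfl | hj
    · simp only [if_true, if_neg hjl.symm]
      exact factor_commute_Y hjl _
    · rcases eq_or_ne l i with rfl | hl
      · simp only [if_true, if_neg hjl]
        exact (factor_commute_X hjl.symm _).symm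
      · simp only [if_neg hj, if_neg hl]
        exact X_commute_Y hjl
  y_y j l hjl := by
    rcases eq_or_ne j i with rfl | hj
    · simp only [if_true, if_neg hjl.symm]
      exact factor_commute_Y hjl _
    · rcases eq_or_ne l i with rfl | hl
      · simp only [if_true, if_neg hjl]
        exact (factor_commute_Y hjl.symm _).symm
      · simp only [if_neg hj, if_neg hl]
        exact Y_commute_Y j l

/-- The endomorphism that is `g` on the `i`-th tensor factor and trivial on the others. -/
def factorHom (i : Fin n)
    (g : (QWAlg d fun _ : Fin 1 => q i) →ₐ[k] QWAlg d fun _ : Fin 1 => q i) :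
    QWAlg d q →ₐ[k] QWAlg d q := (factorRealization i g).lift

variable {i : Fin n} (g : (QWAlg d fun _ : Fin 1 => q i) →ₐ[k] QWAlg d fun _ : Fin 1 => q i)

theorem factorHom_X {j : Fin n} (hj : j ≠ i) : factorHom i g (X d q j) = X d q j :=
  ((factorRealization i g).lift_X j).trans (if_neg hj)

theorem factorHom_Y {j : Fin n} (hj : j ≠ i) : factorHom i g (Y d q j) = Y d q j :=
  ((factorRealization i g).lift_Y j).trans (if_neg hj)

theorem factorHom_H {j : Fin n} (hj : j ≠ i) :
    factorHom i g (H d q j : QWAlg d q) = H d q j :=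
  ((factorRealization i g).lift_H j).trans (congrArg Units.val (if_neg hj))

theorem factorHom_factor (a : QWAlg d fun _ : Fin 1 => q i) :
    factorHom i g (factor d q i a) = factor d q i (g a) := by
  have : (factorHom i g).comp (factor d q i) = (factor d q i).comp g := by
    refine algHom_ext (fun j => ?_) (fun j => ?_) (fun j => ?_)
    · rw [AlgHom.comp_apply, factor_X, Subsingleton.elim j 0]
      exact ((factorRealization i g).lift_X i).trans (if_pos rfl)
    · rw [AlgHom.comp_apply, factor_Y, Subsingleton.elim j 0]
      exact ((factorRealization i g).lift_Y i).trans (if_pos rfl)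
    · rw [AlgHom.comp_apply, factor_H, Subsingleton.elim j 0]
      exact ((factorRealization i g).lift_H i).trans (congrArg Units.val (if_pos rfl))
  exact DFunLike.congr_fun this a

theorem factorHom_comp {g g' : (QWAlg d fun _ : Fin 1 => q i) →ₐ[k] QWAlg d fun _ : Fin 1 => q i}
    (h : ∀ a, g (g' a) = a) : (factorHom i g).comp (factorHom i g') = AlgHom.id k _ := by
  refine algHom_ext (fun j => ?_) (fun j => ?_) (fun j => ?_) <;>
    rw [AlgHom.comp_apply, AlgHom.id_apply] <;> rcases eq_or_ne j i with rfl | hj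
  · rw [← factor_X j 0, factorHom_factor, factorHom_factor, h]
  · rw [factorHom_X _ hj, factorHom_X _ hj]
  · rw [← factor_Y j 0, factorHom_factor, factorHom_factor, h]
  · rw [factorHom_Y _ hj, factorHom_Y _ hj]
  · rw [← factor_H j 0, factorHom_factor, factorHom_factor, h]
  · rw [factorHom_H _ hj, factorHom_H _ hj]

/-- The automorphism that is `g` on the `i`-th tensor factor and trivial on the others. -/
def factorAut (i : Fin n)
    (g : (QWAlg d fun _ : Fin 1 => q i) ≃ₐ[k] QWAlg d fun _ : Fin 1 => q i) :
    QWAlg d q ≃ₐ[k] QWAlg d q :=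
  AlgEquiv.ofAlgHom (factorHom i g.toAlgHom) (factorHom i g.symm.toAlgHom)
    (factorHom_comp g.apply_symm_apply) (factorHom_comp g.symm_apply_apply)

end factors

/-! ### Tame automorphisms supported on one factor -/

section tame

variable {d : ℕ} {q : kˣ}

/-- An automorphism that fixes the generators of all tensor factors but the `i`-th. -/
def FixesOthers (i : Fin n) (τ : Aut n d q) : Prop :=
  ∀ j, j ≠ i → τ (H d (fun _ => q) j) = H d (fun _ => q) j ∧
    τ (X d (fun _ => q) j) = X d (fun _ => q) j ∧ τ (Y d (fun _ => q) j) = Y d (fun _ => q) j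

theorem FixesOthers.mul {i : Fin n} {τ τ' : Aut n d q} (h : FixesOthers i τ)
    (h' : FixesOthers i τ') : FixesOthers i (τ * τ') := by
  intro j hj
  simp only [AlgEquiv.mul_apply, h' j hj, h j hj, and_self]

theorem factorAut_mem [NeZero n] (g : Aut 1 d q) :
    factorAut (q := fun _ : Fin n => q) 0 g ∈ qwaTame n d q :=
  Subgroup.subset_closure (Or.inl (Or.inl ⟨g, fun a =>
    factorHom_factor (q := fun _ : Fin n => q) g.toAlgHom a, fun _ hj =>
    ⟨factorHom_H _ hj, factorHom_X _ hj, factorHom_Y _ hj⟩⟩))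

/-- Automorphisms of any one tensor factor extend to tame automorphisms. -/
theorem exists_tame_of_factor [NeZero n] (i : Fin n) (g : Aut 1 d q) :
    ∃ τ ∈ qwaTame n d q, FixesOthers i τ ∧
      ∀ a, τ (factor d (fun _ => q) i a) = factor d (fun _ => q) i (g a) := by
  -- The family `φ_g` acts on the first factor only; conjugation by a transposition moves it to the
  -- `i`-th. The transposition is its own inverse.
  let w := Equiv.swap (0 : Fin n) i
  refine ⟨permAut d q w * factorAut (q := fun _ : Fin n => q) 0 g * permAut d q w,
    mul_mem (mul_mem (permAut_mem w) (factorAut_mem g)) (permAut_mem w), fun j hj => ?_,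
    fun a => ?_⟩
  · have hw : w j ≠ 0 := fun h => hj
      ((Equiv.swap_apply_self 0 i j).symm.trans ((congrArg w h).trans (Equiv.swap_apply_left 0 i)))
    have hww : w (w j) = j := Equiv.swap_apply_self 0 i j
    refine ⟨?_, ?_, ?_⟩
    · change permHom d q w (factorHom 0 _ (permHom d q w _)) = _
      rw [permHom_H, factorHom_H _ hw, permHom_H, hww]
    · change permHom d q w (factorHom 0 _ (permHom d q w _)) = _
      rw [permHom_X, factorHom_X _ hw, permHom_X, hww]
    · change permHom d q w (factorHom 0 _ (permHom d q w _)) = _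
      rw [permHom_Y, factorHom_Y _ hw, permHom_Y, hww]
  · have h : ∀ j l, w j = l → ∀ a, permHom d q w (factor d (fun _ : Fin n => q) j a) =
        factor d (fun _ => q) l a := by
      rintro j l rfl a
      have : (permHom d q w).comp (factor d (fun _ : Fin n => q) j) =
          factor d (fun _ => q) (w j) :=
        algHom_ext (fun _ => by simp) (fun _ => by simp) (fun _ => by simp)
      exact DFunLike.congr_fun this a
    change permHom d q w (factorHom 0 _ (permHom d q w _)) = _
    rw [h i 0 (Equiv.swap_apply_right 0 i)]
    exact (congrArg (permHom d q w)
      (factorHom_factor (q := fun _ : Fin n => q) g.toAlgHom a)).trans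
      (h 0 i (Equiv.swap_apply_left 0 i) _)

end tame

/-! ### Scaling, inversion and exchange in `A(1,d,q)` -/

section oneFactor

variable {d : ℕ} {q : kˣ}

/-- The endomorphism `h ↦ β h`, `x ↦ x`, `y ↦ y` of `A(1,d,q)`, where `β^d = 1`. -/
def scaleHom (d : ℕ) (q : kˣ) {β : kˣ} (hβ : β ^ d = 1) :
    QWAlg d (fun _ : Fin 1 => q) →ₐ[k] QWAlg d (fun _ : Fin 1 => q) :=
  Realization.lift
    { x := fun i => X d _ i
      y := fun i => Y d _ i
      h := fun i => hMon d _ i β 1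
      x_h := fun i => by
        rw [X_mul_hMon, ← smul_mul_assoc, smul_hMon, zpow_one, mul_comm]
      y_h := fun i => by
        rw [Y_mul_hMon, ← smul_mul_assoc, smul_hMon, zpow_neg_one, mul_comm]
      x_y := fun i => by
        rw [X_mul_Y_eq_hMon, smul_hMon, coe_hMon_pow, mul_pow, hβ, mul_one, one_mul]
      y_x := fun i => by
        rw [Y_mul_X_eq_hMon, coe_hMon_pow, hβ, one_mul]
      h_h := fun i j hij => absurd (Subsingleton.elim i j) hij
      h_x := fun i j hij => absurd (Subsingleton.elim i j) hij
      h_y := fun i j hij => absurd (Subsingleton.elim i j) hij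
      x_x := fun i j hij => absurd (Subsingleton.elim i j) hij
      x_y_comm := fun i j hij => absurd (Subsingleton.elim i j) hij
      y_y := fun i j hij => absurd (Subsingleton.elim i j) hij }

/-- The endomorphism `h ↦ h⁻¹`, `x ↦ x`, `y ↦ -h^{-d} y` of `A(1,d,q)`, where `q⁻¹ = q`. -/
def invertHom (d : ℕ) {q : kˣ} (hq : q⁻¹ = q) :
    QWAlg d (fun _ : Fin 1 => q) →ₐ[k] QWAlg d (fun _ : Fin 1 => q) :=
  Realization.lift
    { x := fun i => X d _ i
      -- Forced by `y' x = h^{-d} - 1 = -h^{-d}(h^d - 1) = -h^{-d} y x`.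
      y := fun i => hMon d (fun _ => q) i (-1) (-d) * Y d (fun _ => q) i
      h := fun i => hMon d _ i 1 (-1)
      x_h := fun i => by
        rw [X_mul_hMon, ← smul_mul_assoc, smul_hMon, zpow_neg_one, hq, mul_comm]
      y_h := fun i => by
        rw [mul_assoc, Y_mul_hMon, ← smul_mul_assoc, smul_hMon, ← mul_assoc, ← mul_assoc,
          coe_hMon_mul, coe_hMon_mul, neg_neg, zpow_one, hq, add_comm]
        simp
      x_y := fun i => by
        rw [← mul_assoc, X_mul_hMon, mul_assoc, X_mul_Y_eq_hMon, mul_sub, coe_hMon_mul,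
          smul_hMon, coe_hMon_pow, neg_add_cancel, mul_one, zpow_neg, zpow_natCast,
          neg_one_mul, neg_mul, inv_mul_cancel, neg_hMon, neg_hMon, hMon_one_zero, mul_one,
          ← inv_pow, hq]
        simp
        abel
      y_x := fun i => by
        rw [mul_assoc, Y_mul_X_eq_hMon, mul_sub, coe_hMon_mul, coe_hMon_pow, neg_add_cancel,
          mul_one, mul_one, neg_hMon, neg_hMon, hMon_one_zero]
        simp
        abel
      h_h := fun i j hij => absurd (Subsingleton.elim i j) hij
      h_x := fun i j hij => absurd (Subsingleton.elim i j) hij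
      h_y := fun i j hij => absurd (Subsingleton.elim i j) hij
      x_x := fun i j hij => absurd (Subsingleton.elim i j) hij
      x_y_comm := fun i j hij => absurd (Subsingleton.elim i j) hij
      y_y := fun i j hij => absurd (Subsingleton.elim i j) hij }

/-- The endomorphism `h ↦ q⁻¹ h⁻¹`, `x ↦ y`, `y ↦ -q^{-d} h^{-d} x` of `A(1,d,q)`. -/
def exchangeHom (d : ℕ) (q : kˣ) :
    QWAlg d (fun _ : Fin 1 => q) →ₐ[k] QWAlg d (fun _ : Fin 1 => q) :=
  Realization.lift
    { x := fun i => Y d _ i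
      -- Forced by `y' y = q^{-d} h^{-d} - 1 = -q^{-d} h^{-d}(q^d h^d - 1) = -q^{-d} h^{-d} x y`.
      y := fun i => hMon d (fun _ => q) i (-(q ^ d)⁻¹) (-d) * X d (fun _ => q) i
      h := fun i => hMon d _ i q⁻¹ (-1)
      x_h := fun i => by
        rw [Y_mul_hMon, ← smul_mul_assoc, smul_hMon, neg_neg, zpow_one, mul_comm]
      y_h := fun i => by
        rw [mul_assoc, X_mul_hMon, ← smul_mul_assoc, smul_hMon, ← mul_assoc, ← mul_assoc,
          coe_hMon_mul, coe_hMon_mul, zpow_neg_one, add_comm, mul_comm (-(q ^ d)⁻¹)]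
      x_y := fun i => by
        rw [← mul_assoc, Y_mul_hMon, mul_assoc, Y_mul_X_eq_hMon, mul_sub, coe_hMon_mul,
          smul_hMon, coe_hMon_pow, neg_add_cancel, mul_one, neg_neg, zpow_natCast, neg_mul,
          inv_mul_cancel, neg_hMon, neg_hMon, hMon_one_zero, mul_one]
        simp
        abel
      y_x := fun i => by
        rw [mul_assoc, X_mul_Y_eq_hMon, mul_sub, coe_hMon_mul, coe_hMon_pow, neg_add_cancel,
          mul_one, neg_mul, inv_mul_cancel, neg_hMon, neg_hMon, hMon_one_zero]
        simp
        abel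
      h_h := fun i j hij => absurd (Subsingleton.elim i j) hij
      h_x := fun i j hij => absurd (Subsingleton.elim i j) hij
      h_y := fun i j hij => absurd (Subsingleton.elim i j) hij
      x_x := fun i j hij => absurd (Subsingleton.elim i j) hij
      x_y_comm := fun i j hij => absurd (Subsingleton.elim i j) hij
      y_y := fun i j hij => absurd (Subsingleton.elim i j) hij }

/-- The endomorphism `h ↦ q⁻¹ h⁻¹`, `x ↦ -h^{-d} y`, `y ↦ x` of `A(1,d,q)`. -/
def exchangeInvHom (d : ℕ) (q : kˣ) :
    QWAlg d (fun _ : Fin 1 => q) →ₐ[k] QWAlg d (fun _ : Fin 1 => q) :=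
  Realization.lift
    { x := fun i => hMon d (fun _ => q) i (-1) (-d) * Y d (fun _ => q) i
      y := fun i => X d _ i
      h := fun i => hMon d _ i q⁻¹ (-1)
      x_h := fun i => by
        rw [mul_assoc, Y_mul_hMon, ← smul_mul_assoc, smul_hMon, ← mul_assoc, ← mul_assoc,
          coe_hMon_mul, coe_hMon_mul, neg_neg, zpow_one, add_comm, mul_comm (-1)]
        simp
      y_h := fun i => by
        rw [X_mul_hMon, ← smul_mul_assoc, smul_hMon, zpow_neg_one]
      x_y := fun i => by
        rw [mul_assoc, Y_mul_X_eq_hMon, mul_sub, coe_hMon_mul, smul_hMon, coe_hMon_pow,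
          neg_add_cancel, mul_one, mul_one, neg_hMon, neg_hMon, hMon_one_zero]
        simp
        abel
      y_x := fun i => by
        rw [← mul_assoc, X_mul_hMon, mul_assoc, X_mul_Y_eq_hMon, mul_sub, coe_hMon_mul,
          coe_hMon_pow, neg_add_cancel, mul_one, zpow_neg, zpow_natCast, neg_one_mul, neg_mul,
          inv_mul_cancel, neg_hMon, neg_hMon, hMon_one_zero]
        simp
        abel
      h_h := fun i j hij => absurd (Subsingleton.elim i j) hij
      h_x := fun i j hij => absurd (Subsingleton.elim i j) hij
      h_y := fun i j hij => absurd (Subsingleton.elim i j) hij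
      x_x := fun i j hij => absurd (Subsingleton.elim i j) hij
      x_y_comm := fun i j hij => absurd (Subsingleton.elim i j) hij
      y_y := fun i j hij => absurd (Subsingleton.elim i j) hij }

section values

variable {β : kˣ} (hβ : β ^ d = 1) (hq : q⁻¹ = q) (i : Fin 1)

theorem scaleHom_X : scaleHom d q hβ (X d _ i) = X d _ i := Realization.lift_X _ i

theorem scaleHom_Y : scaleHom d q hβ (Y d _ i) = Y d _ i := Realization.lift_Y _ i

theorem scaleHom_H : scaleHom d q hβ (H d (fun _ => q) i : QWAlg d fun _ => q) =
    hMon d (fun _ => q) i β 1 := Realization.lift_H _ i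

theorem invertHom_X : invertHom d hq (X d _ i) = X d _ i := Realization.lift_X _ i

theorem invertHom_Y : invertHom d hq (Y d _ i) = hMon d (fun _ => q) i (-1) (-d) * Y d (fun _ => q) i :=
  Realization.lift_Y _ i

theorem invertHom_H : invertHom d hq (H d (fun _ => q) i : QWAlg d fun _ => q) =
    hMon d (fun _ => q) i 1 (-1) := Realization.lift_H _ i

theorem exchangeHom_X : exchangeHom d q (X d _ i) = Y d _ i := Realization.lift_X _ i

theorem exchangeHom_Y :
    exchangeHom d q (Y d _ i) = hMon d (fun _ => q) i (-(q ^ d)⁻¹) (-d) * X d (fun _ => q) i :=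
  Realization.lift_Y _ i

theorem exchangeHom_H : exchangeHom d q (H d (fun _ => q) i : QWAlg d fun _ => q) =
    hMon d (fun _ => q) i q⁻¹ (-1) := Realization.lift_H _ i

theorem exchangeInvHom_X :
    exchangeInvHom d q (X d _ i) = hMon d (fun _ => q) i (-1) (-d) * Y d (fun _ => q) i := Realization.lift_X _ i

theorem exchangeInvHom_Y : exchangeInvHom d q (Y d _ i) = X d _ i := Realization.lift_Y _ i

theorem exchangeInvHom_H : exchangeInvHom d q (H d (fun _ => q) i : QWAlg d fun _ => q) =
    hMon d (fun _ => q) i q⁻¹ (-1) := Realization.lift_H _ i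

end values

theorem scaleHom_comp {β γ : kˣ} (hβ : β ^ d = 1) (hγ : γ ^ d = 1) (h : β * γ = 1) :
    (scaleHom d q hβ).comp (scaleHom d q hγ) = AlgHom.id k _ := by
  refine algHom_ext (fun i => ?_) (fun i => ?_) (fun i => ?_) <;>
    rw [AlgHom.comp_apply, AlgHom.id_apply]
  · rw [scaleHom_X, scaleHom_X]
  · rw [scaleHom_Y, scaleHom_Y]
  · rw [scaleHom_H, map_hMon (scaleHom_H hβ i), zpow_one, mul_comm γ, h, one_mul, ← H_eq_hMon]

/-- The automorphism `h ↦ β h`, `x ↦ x`, `y ↦ y` of `A(1,d,q)`, where `β^d = 1`. -/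
def scaleAut (d : ℕ) (q : kˣ) {β : kˣ} (hβ : β ^ d = 1) : Aut 1 d q :=
  AlgEquiv.ofAlgHom (scaleHom d q hβ) (scaleHom d q (β := β⁻¹) (by rw [inv_pow, hβ, inv_one]))
    (scaleHom_comp _ _ (mul_inv_cancel β)) (scaleHom_comp _ _ (inv_mul_cancel β))

theorem invertHom_comp (hq : q⁻¹ = q) :
    (invertHom d hq).comp (invertHom d hq) = AlgHom.id k _ := by
  refine algHom_ext (fun i => ?_) (fun i => ?_) (fun i => ?_) <;>
    rw [AlgHom.comp_apply, AlgHom.id_apply]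
  · rw [invertHom_X, invertHom_X]
  · rw [invertHom_Y, map_mul, map_hMon (invertHom_H hq i), invertHom_Y, ← mul_assoc,
      coe_hMon_mul, one_zpow, mul_one, neg_mul_neg, mul_one, neg_mul_neg, one_mul,
      add_neg_cancel, hMon_one_zero, Units.val_one, one_mul]
  · rw [invertHom_H, map_hMon (invertHom_H hq i), one_zpow, mul_one, neg_mul_neg, one_mul,
      ← H_eq_hMon]

/-- The automorphism `h ↦ h⁻¹`, `x ↦ x`, `y ↦ -h^{-d} y` of `A(1,d,q)`, where `q⁻¹ = q`. -/
def invertAut (d : ℕ) {q : kˣ} (hq : q⁻¹ = q) : Aut 1 d q :=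
  AlgEquiv.ofAlgHom (invertHom d hq) (invertHom d hq) (invertHom_comp hq) (invertHom_comp hq)

/-- The automorphism `h ↦ q⁻¹ h⁻¹`, `x ↦ y`, `y ↦ -q^{-d} h^{-d} x` of `A(1,d,q)`. -/
def exchangeAut (d : ℕ) (q : kˣ) : Aut 1 d q :=
  AlgEquiv.ofAlgHom (exchangeHom d q) (exchangeInvHom d q)
    (by
      refine algHom_ext (fun i => ?_) (fun i => ?_) (fun i => ?_) <;>
        rw [AlgHom.comp_apply, AlgHom.id_apply]
      · rw [exchangeInvHom_X, map_mul, map_hMon (exchangeHom_H i), exchangeHom_Y, ← mul_assoc,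
          coe_hMon_mul, neg_mul_neg, one_mul, add_neg_cancel, zpow_neg, inv_zpow, inv_inv,
          zpow_natCast, neg_one_mul, neg_mul_neg, mul_inv_cancel, hMon_one_zero, Units.val_one,
          one_mul]
      · rw [exchangeInvHom_Y, exchangeHom_X]
      · rw [exchangeInvHom_H, map_hMon (exchangeHom_H i), zpow_neg_one, inv_inv, inv_mul_cancel,
          neg_mul_neg, one_mul, ← H_eq_hMon])
    (by
      refine algHom_ext (fun i => ?_) (fun i => ?_) (fun i => ?_) <;>
        rw [AlgHom.comp_apply, AlgHom.id_apply]
      · rw [exchangeHom_X, exchangeInvHom_Y]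
      · rw [exchangeHom_Y, map_mul, map_hMon (exchangeInvHom_H i), exchangeInvHom_X, ← mul_assoc,
          coe_hMon_mul, neg_mul_neg, one_mul, add_neg_cancel, zpow_neg, inv_zpow, inv_inv,
          zpow_natCast, neg_mul, inv_mul_cancel, neg_mul_neg, one_mul, hMon_one_zero,
          Units.val_one, one_mul]
      · rw [exchangeHom_H, map_hMon (exchangeInvHom_H i), zpow_neg_one, inv_inv, inv_mul_cancel,
          neg_mul_neg, one_mul, ← H_eq_hMon])

end oneFactor

/-! ### Normalising an automorphism on one factor -/

section reduction

variable {d : ℕ} {q : kˣ}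

/-- The automorphism fixes `h_i` and multiplies `x_i` by a unit. -/
def IsNormalAt (ψ : Aut n d q) (i : Fin n) : Prop :=
  ψ (H d (fun _ => q) i) = H d (fun _ => q) i ∧
    ∃ u : (Laurent k n)ˣ, ψ (X d (fun _ => q) i) = ofLaurent d (fun _ => q) u * X d (fun _ => q) i

/-- The automorphism can be made normal at `i` by a tame automorphism acting only on the `i`-th
tensor factor. -/
def IsReducibleAt [NeZero n] (ψ : Aut n d q) (i : Fin n) : Prop :=
  ∃ τ ∈ qwaTame n d q, FixesOthers i τ ∧ IsNormalAt (ψ * τ) i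

variable [NeZero n] {ψ : Aut n d q} {i : Fin n}

theorem IsReducibleAt.of_mul {τ : Aut n d q} (hτ : τ ∈ qwaTame n d q) (hi : FixesOthers i τ)
    (h : IsReducibleAt (ψ * τ) i) : IsReducibleAt ψ i := by
  obtain ⟨τ', hτ', hi', h'⟩ := h
  exact ⟨τ * τ', mul_mem hτ hτ', hi.mul hi', by rwa [← mul_assoc]⟩

theorem IsReducibleAt.of_scale {α : kˣ} (hα : α ^ d = 1)
    (hH : ψ (H d (fun _ => q) i) = hMon d (fun _ => q) i α 1) {u : (Laurent k n)ˣ}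
    (hX : ψ (X d (fun _ => q) i) = ofLaurent d (fun _ => q) u * X d (fun _ => q) i) :
    IsReducibleAt ψ i := by
  have hβ : α⁻¹ ^ d = 1 := by rw [inv_pow, hα, inv_one]
  obtain ⟨τ, hτ, hi, h⟩ := exists_tame_of_factor i (scaleAut d q hβ)
  have h1 := h (H d (fun _ : Fin 1 => q) 0).val
  have h2 := h (X d (fun _ => q) 0)
  rw [factor_H] at h1
  rw [factor_X] at h2
  refine ⟨τ, hτ, hi, ?_, u, ?_⟩
  · rw [AlgEquiv.mul_apply, h1]
    change ψ (factor d _ i (scaleHom d q hβ _)) = _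
    rw [scaleHom_H]
    erw [factor_hMon]
    refine (map_hMon (F := ψ.toAlgHom) hH _ _).trans ?_
    rw [zpow_one, inv_mul_cancel, one_mul, ← H_eq_hMon]
  · rw [AlgEquiv.mul_apply, h2]
    change ψ (factor d _ i (scaleHom d q hβ _)) = _
    rw [scaleHom_X]
    erw [factor_X]
    exact hX

/-- For `c = -1` the condition `q ^ c = q` is exactly what makes the inversion of `h` with `x` fixed
an automorphism; precomposing with it turns `c` into 1, and a scaling then removes the scalar. -/
theorem IsReducibleAt.of_X {α : kˣ} {c : ℤ} (hc : c = 1 ∨ c = -1) (hα : α ^ d = 1)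
    (hqc : q ^ c = q) (hH : ψ (H d (fun _ => q) i) = hMon d (fun _ => q) i α c)
    {u : (Laurent k n)ˣ}
    (hX : ψ (X d (fun _ => q) i) = ofLaurent d (fun _ => q) u * X d (fun _ => q) i) :
    IsReducibleAt ψ i := by
  rcases hc with rfl | rfl
  · exact of_scale hα hH hX
  rw [zpow_neg_one] at hqc
  obtain ⟨τ, hτ, hi, h⟩ := exists_tame_of_factor i (invertAut d hqc)
  have h1 := h (H d (fun _ : Fin 1 => q) 0).val
  have h2 := h (X d (fun _ => q) 0)
  rw [factor_H] at h1
  rw [factor_X] at h2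
  refine IsReducibleAt.of_mul hτ hi (of_scale (α := α⁻¹) (u := u) ?_ ?_ ?_)
  · rw [inv_pow, hα, inv_one]
  · rw [AlgEquiv.mul_apply, h1]
    change ψ (factor d _ i (invertHom d hqc _)) = _
    rw [invertHom_H]
    erw [factor_hMon]
    refine (map_hMon (F := ψ.toAlgHom) hH _ _).trans ?_
    rw [one_mul, zpow_neg_one, neg_mul_neg, one_mul]
  · rw [AlgEquiv.mul_apply, h2]
    change ψ (factor d _ i (invertHom d hqc _)) = _
    rw [invertHom_X]
    erw [factor_X]
    exact hX

/-- Precomposing with the exchange makes `x_i` go where `y_i` went. Since it sends `h` to `q⁻¹ h⁻¹`,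
the pair `(α, c)` becomes `((qα)⁻¹, -c)`, which meets the conditions of `of_X`. -/
theorem IsReducibleAt.of_Y {α : kˣ} {c : ℤ} (hc : c = 1 ∨ c = -1) (hα : (q * α) ^ d = 1)
    (hqc : q ^ (-c) = q) (hH : ψ (H d (fun _ => q) i) = hMon d (fun _ => q) i α c)
    {u : (Laurent k n)ˣ}
    (hY : ψ (Y d (fun _ => q) i) = ofLaurent d (fun _ => q) u * X d (fun _ => q) i) :
    IsReducibleAt ψ i := by
  obtain ⟨τ, hτ, hi, h⟩ := exists_tame_of_factor i (exchangeAut d q)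
  have h1 := h (H d (fun _ : Fin 1 => q) 0).val
  have h2 := h (X d (fun _ => q) 0)
  rw [factor_H] at h1
  rw [factor_X] at h2
  refine IsReducibleAt.of_mul hτ hi
    (of_X (α := (q * α)⁻¹) (c := -c) (u := u) (by omega) ?_ hqc ?_ ?_)
  · rw [inv_pow, hα, inv_one]
  · rw [AlgEquiv.mul_apply, h1]
    change ψ (factor d _ i (exchangeHom d q _)) = _
    rw [exchangeHom_H]
    erw [factor_hMon]
    refine (map_hMon (F := ψ.toAlgHom) hH _ _).trans ?_
    rw [zpow_neg_one, mul_inv, mul_neg_one]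
  · rw [AlgEquiv.mul_apply, h2]
    change ψ (factor d _ i (exchangeHom d q _)) = _
    rw [exchangeHom_X]
    erw [factor_Y]
    exact hY

end reduction

/-! ### Recognising the automorphisms `ξ_u` -/

section diagonal

variable {d : ℕ}

/-- In the torus `x_i` becomes the invertible element `t_i`. -/
theorem X_mul_right_cancel (hd : 0 < d) {q : Fin n → kˣ} {i : Fin n} {a b : QWAlg d q}
    (h : a * X d q i = b * X d q i) : a = b := by
  have h1 : toTorus d q (X d q i) * SkewMonoidAlgebra.single (deg q (-Pi.single i 1)) 1 = 1 := by
    rw [toTorus_X, coe_single_mul, add_neg_cancel, map_one, mul_one]; rfl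
  have h2 := congrArg
    (fun z => toTorus d q z * SkewMonoidAlgebra.single (deg q (-Pi.single i 1)) 1) h
  simp only [map_mul, mul_assoc, h1, mul_one] at h2
  exact toTorus_injective hd h2

variable {q : kˣ} [NeZero n]

/-- An automorphism that is normal at every index is one of the `ξ_u`. -/
theorem mem_qwaTame_of_forall_isNormalAt (hd : 0 < d) {ψ : Aut n d q}
    (h : ∀ i, IsNormalAt ψ i) : ψ ∈ qwaTame n d q := by
  choose hH u hu using h
  let U : Fin n → (QWAlg d fun _ : Fin n => q)ˣ := fun i => Units.map
    (ofLaurent d (fun _ : Fin n => q) : Laurent k n →* QWAlg d fun _ : Fin n => q) (u i)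
  refine Subgroup.subset_closure (Or.inr ⟨U,
    ⟨fun i => u i, fun _ => rfl, fun i l _ => ?_⟩, fun i => ⟨hH i, hu i, ?_⟩⟩)
  -- Admissibility is the image of `x_i x_l = x_l x_i` after cancelling `x_i` and `x_l`.
  · have hψ : ∀ i l, ψ (X d _ i * X d _ l) =
        ofLaurent d _ (u i * sigma (fun _ => q) i (u l) : Laurent k n) *
          X d _ i * X d _ l := by
      intro i l
      rw [map_mul, hu, hu, mul_assoc, ← mul_assoc (X d _ i), X_mul_ofLaurent, ← mul_assoc,
        ← mul_assoc, ← map_mul, sigma_eq_twist]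
    have h1 := hψ i l
    rw [(X_commute_X i l).eq, hψ l i, mul_assoc, (X_commute_X l i).eq, ← mul_assoc] at h1
    exact (ofLaurent_injective (X_mul_right_cancel hd (X_mul_right_cancel hd h1))).symm
  -- The value at `y_i` is determined: `ψ(y_i) u_i x_i = ψ(y_i x_i) = h_i^d - 1 = y_i x_i`, and
  -- `x_i` cancels.
  · rw [Units.eq_mul_inv_iff_mul_eq]
    refine X_mul_right_cancel hd (i := i) ?_
    rw [mul_assoc, Y_mul_X]
    change ψ (Y d _ i) * (ofLaurent d _ (u i : Laurent k n) * X d _ i) = _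
    rw [← hu, ← map_mul, Y_mul_X, map_sub, map_pow, hH, map_one]

end diagonal

/-! ### Assembly of the normalisations -/

section main

variable {d : ℕ} {q : kˣ}

/-- The automorphism preserves the `i`-th tensor factor up to units of the Laurent polynomials. -/
def IsDiagonalAt (ψ : Aut n d q) (i : Fin n) : Prop :=
  ∃ α c, (c = 1 ∨ c = -1) ∧ ψ (H d (fun _ => q) i) = hMon d (fun _ => q) i α c ∧
    ((α ^ d = 1 ∧ q ^ c = q ∧ ∃ u : (Laurent k n)ˣ,
        ψ (X d (fun _ => q) i) = ofLaurent d (fun _ => q) u * X d (fun _ => q) i) ∨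
      ((q * α) ^ d = 1 ∧ q ^ (-c) = q ∧ ∃ u : (Laurent k n)ˣ,
        ψ (Y d (fun _ => q) i) = ofLaurent d (fun _ => q) u * X d (fun _ => q) i))

theorem IsDiagonalAt.mul_of_fixesOthers {ψ τ : Aut n d q} {i j : Fin n} (hij : j ≠ i)
    (hτ : FixesOthers i τ) (h : IsDiagonalAt ψ j) : IsDiagonalAt (ψ * τ) j := by
  simpa only [IsDiagonalAt, AlgEquiv.mul_apply, (hτ j hij).1, (hτ j hij).2.1, (hτ j hij).2.2]
    using h

theorem IsNormalAt.mul_of_fixesOthers {ψ τ : Aut n d q} {i j : Fin n} (hij : j ≠ i)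
    (hτ : FixesOthers i τ) (h : IsNormalAt ψ j) : IsNormalAt (ψ * τ) j := by
  obtain ⟨h1, u, h2⟩ := h
  refine ⟨?_, u, ?_⟩
  · rw [AlgEquiv.mul_apply, (hτ j hij).1, h1]
  · rw [AlgEquiv.mul_apply, (hτ j hij).2.1, h2]

variable [NeZero n]

theorem IsDiagonalAt.isReducibleAt {ψ : Aut n d q} {i : Fin n} (h : IsDiagonalAt ψ i) :
    IsReducibleAt ψ i := by
  obtain ⟨α, c, hc, hH, ⟨hα, hqc, u, hu⟩ | ⟨hα, hqc, u, hu⟩⟩ := h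
  · exact IsReducibleAt.of_X hc hα hqc hH hu
  · exact IsReducibleAt.of_Y hc hα hqc hH hu

/-- Induction on the set `S` of indices still to be normalised. The correction at `i` acts on the
`i`-th factor only, so what is known at the other indices survives. -/
theorem mem_qwaTame_of_isDiagonalAt (hd : 0 < d) (S : Finset (Fin n)) (ψ : Aut n d q)
    (hS : ∀ i ∈ S, IsDiagonalAt ψ i) (hS' : ∀ i ∉ S, IsNormalAt ψ i) : ψ ∈ qwaTame n d q := by
  induction S using Finset.induction_on generalizing ψ with
  | empty => exact mem_qwaTame_of_forall_isNormalAt hd fun i => hS' i (Finset.notMem_empty i)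
  | insert i S hi ih =>
    obtain ⟨τ, hτ, hfix, hn⟩ := (hS i (Finset.mem_insert_self i S)).isReducibleAt
    refine (Subgroup.mul_mem_cancel_right _ hτ).1 (ih (ψ * τ) (fun j hj => ?_) fun j hj => ?_)
    · exact (hS j (Finset.mem_insert_of_mem hj)).mul_of_fixesOthers
        (ne_of_mem_of_not_mem hj hi) hfix
    · rcases eq_or_ne j i with rfl | hji
      · exact hn
      · exact (hS' j (by simp [hj, hji])).mul_of_fixesOthers hji hfix

end main

end QWA

end

/-- Every automorphism of `A(n,d,(q,…,q))` is qwa-tame. -/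
theorem corollary5p3 {k : Type*} [Field k] (n d : ℕ) [NeZero n] (hd : 0 < d)
    (q : kˣ) (hq : q ^ d ≠ 1) (ψ : QWA.Aut n d q) :
    ψ ∈ QWA.qwaTame n d q := by
  have hq1 : q ≠ 1 := by
    rintro rfl
    exact hq (one_pow d)
  obtain ⟨w, hw⟩ := QWA.exists_perm hd hq1 ψ
  -- Precomposing with the permutation `w⁻¹` makes ψ diagonal: `h_i` first goes to the index
  -- `w⁻¹(i)`, which ψ returns to `i`.
  refine (Subgroup.mul_mem_cancel_right _ (QWA.permAut_mem w.symm)).1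
    (QWA.mem_qwaTame_of_isDiagonalAt hd Finset.univ _ (fun i _ => ?_) (by simp))
  obtain ⟨α, c, hc, hH, h⟩ := hw (w.symm i)
  rw [Equiv.apply_symm_apply] at hH h
  have h1 := congrArg ψ (QWA.permHom_H (d := d) (q := q) w.symm i)
  have h2 := congrArg ψ (QWA.permHom_X (d := d) (q := q) w.symm i)
  have h3 := congrArg ψ (QWA.permHom_Y (d := d) (q := q) w.symm i)
  refine ⟨α, c, hc, h1.trans hH, ?_⟩
  rcases h with ⟨hα, hqc, u, hu⟩ | ⟨hα, hqc, u, hu⟩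
  · exact Or.inl ⟨hα, hqc, u, h2.trans hu⟩
  · exact Or.inr ⟨hα, hqc, u, h3.trans hu⟩
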